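/- Let $F$ be a non-archimedean local field with ring of integers $\mathfrak{o}$, uniformizer $\varpi$ and residue field of cardinality $q$, and let $K=\mathrm{GL}_2(\mathfrak{o})$. Let $C_c^\infty(\mathrm{GL}_2(F)/\!/K)$ be the space of compactly supported locally constant $K$-bi-invariant functions $\mathrm{GL}_2(F)\to\mathbb{C}$, let $*$ be convolution with respect to the Haar measure giving $K$ volume $1$, and let $$\mathcal{S}:C_c^\infty(\mathrm{GL}_2(F)/\!/K)\to\mathbb{C}[t_1^{\pm1},t_2^{\pm1}],\qquad \mathcal{S}f=\sum_{a,b\in\mathbb{Z}}\Big(q^{(b-a)/2}\int_F f\big(\begin{smallmatrix}\varpi^a&\\&\varpi^b\end{smallmatrix}\big)\big(\begin{smallmatrix}1&x\\&1\end{smallmatrix}\big)\,dx\Big)t_1^at_2^b$$ (with $\mathrm{vol}(\mathfrak{o})=1$; the integrand is $f$ evaluated at the product of the two matrices) be the Satake transform. For $m\ge0$ and $i\in\mathbb{Z}$ put $$\mathbb{1}_m=\sum_{a\ge b\ge0,\ a+b=m}\mathbb{1}_{K\,\mathrm{diag}(\varpi^a,\varpi^b)K},\qquad \mathbb{1}_{i,i}=\mathbb{1}_{K\,\mathrm{diag}(\varpi^i,\varpi^i)K}.$$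 Let $\mathrm{Sym}^j(\mathrm{Sym}^k(t_1,t_2))$ denote the complete homogeneous symmetric polynomial of degree $j$ evaluated at $t_1^{k},t_1^{k-1}t_2,\dots,t_2^{k}$. For $j\ge0$ let $$S_j=\sum_{n=0}^{2j}q^n\sum_{s=0}^{\lfloor n/4\rfloor}\Big(\Big\lfloor\frac{n-4s}{2}\Big\rfloor-\Big\lfloor\frac{n-4s-1}{3}\Big\rfloor\Big)\mathbb{1}_{4j-2n}*\mathbb{1}_{n,n}-\sum_{n=j+1}^{2j}q^n\sum_{s=0}^{n-j-1}\Big(\Big\lfloor\frac{s}{2}\Big\rfloor-\Big\lfloor\frac{s-1}{3}\Big\rfloor\Big)\mathbb{1}_{4j-2n}*\mathbb{1}_{n,n}.$$ Then, for every $j\ge 0$, $\mathrm{Sym}^j(\mathrm{Sym}^4(t_1,t_2))$ has exactly one preimage under $\mathcal{S}$, and the basic function $$\mathbb{L}(\mathrm{Sym}^4)=\sum_{j=0}^\infty\mathcal{S}^{-1}\big(\mathrm{Sym}^j(\mathrm{Sym}^4(t_1,t_2))\big)$$ satisfies $$\mathbb{L}(\mathrm{Sym}^4)=\sum_{j=0}^\infty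 S_j\,q^{-2j}$$ as functions on $\mathrm{GL}_2(F)$, where at every $g\in\mathrm{GL}_2(F)$ both sums have only finitely many nonzero terms. -/

import Mathlib

open scoped ValuativeRel Matrix AddMonoidAlgebra

namespace SatakeGL2

noncomputable section

variable (F : Type*) [Field F] [ValuativeRel F] [TopologicalSpace F] [IsNonarchimedeanLocalField F]

/-- `q`, the cardinality of the residue field of `F`. -/
def q : ℕ := Nat.card 𝓀[F]

/-- The maximal compact subgroup `K = GL₂(𝔬)` of `GL₂(F)`. -/
def maxCompact : Subgroup (GL (Fin 2) F) :=
  (Matrix.GeneralLinearGroup.map (n := Fin 2) (algebraMap 𝒪[F] F)).range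

variable {F}

/-- `ϖ` is a uniformizer: a generator of the maximal ideal `𝔭` of `𝔬`. -/
def IsUniformizer (ϖ : Fˣ) : Prop :=
  ∃ p : 𝒪[F], (p : F) = ϖ ∧ 𝓂[F] = Ideal.span {p}

/-- The diagonal matrix `diag(ϖ^a, ϖ^b)`. -/
def torus (ϖ : Fˣ) (a b : ℤ) : GL (Fin 2) F where
  val := !![(ϖ : F) ^ a, 0; 0, (ϖ : F) ^ b]
  inv := !![(ϖ : F) ^ (-a), 0; 0, (ϖ : F) ^ (-b)]
  val_inv := by simp [Matrix.one_fin_two, zpow_ne_zero]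
  inv_val := by simp [Matrix.one_fin_two, zpow_ne_zero]

/-- The unipotent matrix with rows `(1, x)` and `(0, 1)`. -/
def unip (x : F) : GL (Fin 2) F := Matrix.GeneralLinearGroup.upperRightHom x

/-! ### Normalized Haar measures -/

variable (F)

theorem t2Space : T2Space F :=
  letI := IsTopologicalAddGroup.rightUniformSpace F
  haveI := isUniformAddGroup_of_addCommGroup (G := F)
  inferInstance

theorem isOpen_integers : IsOpen (𝒪[F] : Set F) :=
  Valuation.isOpen_integer

theorem isCompact_integers : IsCompact (𝒪[F] : Set F) :=
  IsNonarchimedeanLocalField.isCompact_closedBall F 1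

theorem isCompact_maxCompact : IsCompact (maxCompact F : Set (GL (Fin 2) F)) := by
  have := t2Space F
  have : CompactSpace (Matrix (Fin 2) (Fin 2) 𝒪[F]) :=
    inferInstanceAs (CompactSpace (Fin 2 → Fin 2 → 𝒪[F]))
  have : CompactSpace (GL (Fin 2) 𝒪[F]) :=
    inferInstanceAs (CompactSpace (Matrix (Fin 2) (Fin 2) 𝒪[F])ˣ)
  have hc : Continuous (algebraMap 𝒪[F] F) := continuous_subtype_val
  have := isCompact_range (hc.generalLinearGroup_map (n := Fin 2))
  rwa [← MonoidHom.coe_range] at this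

theorem mem_maxCompact_iff (g : GL (Fin 2) F) :
    g ∈ maxCompact F ↔
      ∀ i j, (g : Matrix (Fin 2) (Fin 2) F) i j ∈ 𝒪[F] ∧
        ((g⁻¹ : GL (Fin 2) F) : Matrix (Fin 2) (Fin 2) F) i j ∈ 𝒪[F] := by
  constructor
  · rintro ⟨k, rfl⟩ i j
    rw [← map_inv]
    exact ⟨(k i j).2, (k⁻¹ i j).2⟩
  · intro h
    refine ⟨⟨Matrix.of fun i j => ⟨_, (h i j).1⟩, Matrix.of fun i j => ⟨_, (h i j).2⟩, ?_, ?_⟩, ?_⟩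
    · ext i j
      have : ((g * g⁻¹ : GL (Fin 2) F) : Matrix (Fin 2) (Fin 2) F) i j =
          ((1 : GL (Fin 2) F) : Matrix (Fin 2) (Fin 2) F) i j := by rw [mul_inv_cancel]
      simp only [Units.val_mul, Matrix.mul_apply, Units.val_one, Matrix.one_apply] at this
      simp only [Matrix.mul_apply, Matrix.one_apply, AddSubmonoidClass.coe_finsetSum,
        Matrix.of_apply, MulMemClass.coe_mul, this]
      split <;> rfl
    · ext i j
      have : ((g⁻¹ * g : GL (Fin 2) F) : Matrix (Fin 2) (Fin 2) F) i j =
          ((1 : GL (Fin 2) F) : Matrix (Fin 2) (Fin 2) F) i j := by rw [inv_mul_cancel]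
      simp only [Units.val_mul, Matrix.mul_apply, Units.val_one, Matrix.one_apply] at this
      simp only [Matrix.mul_apply, Matrix.one_apply, AddSubmonoidClass.coe_finsetSum,
        Matrix.of_apply, MulMemClass.coe_mul, this]
      split <;> rfl
    · ext i j
      rfl

theorem isOpen_maxCompact : IsOpen (maxCompact F : Set (GL (Fin 2) F)) := by
  have h : (maxCompact F : Set (GL (Fin 2) F)) = ⋂ i : Fin 2, ⋂ j : Fin 2,
      {g : GL (Fin 2) F | (g : Matrix (Fin 2) (Fin 2) F) i j ∈ 𝒪[F]} ∩
      {g : GL (Fin 2) F | ((g⁻¹ : GL (Fin 2) F) : Matrix (Fin 2) (Fin 2) F) i j ∈ 𝒪[F]} := by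
    ext g
    simp only [SetLike.mem_coe, mem_maxCompact_iff, Set.mem_iInter]
    rfl
  rw [h]
  refine isOpen_iInter_of_finite fun i => isOpen_iInter_of_finite fun j => IsOpen.inter ?_ ?_
  · exact (isOpen_integers F).preimage (Units.continuous_val.matrix_elem i j)
  · exact (isOpen_integers F).preimage
      ((Units.continuous_val.comp continuous_inv).matrix_elem i j)

/-- The Haar measure on (the Borel sets of) `F` with `vol(𝔬) = 1`. -/
def haarF : @MeasureTheory.Measure F (borel F) :=
  letI : MeasurableSpace F := borel F
  haveI : BorelSpace F := ⟨rfl⟩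
  MeasureTheory.Measure.addHaarMeasure
    ⟨⟨(𝒪[F] : Set F), isCompact_integers F⟩,
      ⟨0, by rw [(isOpen_integers F).interior_eq]; exact zero_mem 𝒪[F]⟩⟩

/-- The Haar measure on (the Borel sets of) `GL₂(F)` with `vol(K) = 1`. -/
def haarGL2 : @MeasureTheory.Measure (GL (Fin 2) F) (borel (GL (Fin 2) F)) :=
  letI : MeasurableSpace (GL (Fin 2) F) := borel (GL (Fin 2) F)
  haveI : BorelSpace (GL (Fin 2) F) := ⟨rfl⟩
  MeasureTheory.Measure.haarMeasure
    ⟨⟨(maxCompact F : Set (GL (Fin 2) F)), isCompact_maxCompact F⟩,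
      ⟨1, by rw [(isOpen_maxCompact F).interior_eq]; exact one_mem (maxCompact F)⟩⟩

/-! ### The unramified Hecke algebra -/

/-- The unramified Hecke algebra `C_c^∞(GL₂(F)//K)`: the locally constant, compactly supported,
`K`-bi-invariant functions `GL₂(F) → ℂ`. -/
def heckeAlgebra : Submodule ℂ (GL (Fin 2) F → ℂ) where
  carrier := {f | IsLocallyConstant f ∧ HasCompactSupport f ∧
    ∀ k ∈ maxCompact F, ∀ g, f (k * g) = f g ∧ f (g * k) = f g}
  zero_mem' := ⟨IsLocallyConstant.const 0, HasCompactSupport.zero, fun _ _ _ => ⟨rfl, rfl⟩⟩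
  add_mem' := by
    rintro f g ⟨hf, hf', hf''⟩ ⟨hg, hg', hg''⟩
    refine ⟨hf.add hg, hf'.add hg', fun k hk x => ?_⟩
    simp [hf'' k hk x, hg'' k hk x]
  smul_mem' := by
    rintro c f ⟨hf, hf', hf''⟩
    refine ⟨hf.comp (fun z => c * z), hf'.comp_left (g := fun z => c * z) (mul_zero c),
      fun k hk x => ?_⟩
    simp [hf'' k hk x]

variable {F}

/-- Convolution `(f₁ * f₂)(g) = ∫ f₁(x) f₂(x⁻¹ g) dx` on `GL₂(F)`. -/
def conv (f₁ f₂ : GL (Fin 2) F → ℂ) : GL (Fin 2) F → ℂ :=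
  fun g => ∫ x, f₁ x * f₂ (x⁻¹ * g) ∂(haarGL2 F)

/-- The characteristic function of the double coset `K g K`. -/
def charDoubleCoset (g : GL (Fin 2) F) : GL (Fin 2) F → ℂ :=
  (DoubleCoset.doubleCoset g (maxCompact F : Set (GL (Fin 2) F)) (maxCompact F)).indicator 1

/-- `𝟙_m` (with `𝟙_0 = 𝟙_K`), the sum of the characteristic functions of `K diag(ϖ^a, ϖ^b) K` over `a ≥ b ≥ 0` with
`a + b = m`. -/
def heckeOne (ϖ : Fˣ) (m : ℕ) : GL (Fin 2) F → ℂ :=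
  ∑ p ∈ Finset.HasAntidiagonal.antidiagonal m with p.2 ≤ p.1, charDoubleCoset (torus ϖ (p.1 : ℤ) (p.2 : ℤ))

/-- `𝟙_{i,i}`, the characteristic function of `K diag(ϖ^i, ϖ^i) K`. -/
def heckeScalar (ϖ : Fˣ) (i : ℤ) : GL (Fin 2) F → ℂ :=
  charDoubleCoset (torus ϖ i i)

/-! ### The Satake transform

The Laurent polynomial ring `ℂ[t₁^{±1}, t₂^{±1}]` is the group algebra `ℂ[ℤ × ℤ]`; the monomial
`t₁^a t₂^b` is `AddMonoidAlgebra.single (a, b) 1`. -/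

/-- The coefficient of `t₁^a t₂^b` in the Satake transform of `f`: with `t = diag(ϖ^a, ϖ^b)`, it is
`δ(t)^{1/2} ∫_F f(t n(x)) dx`, where `δ(t) = |ϖ^a / ϖ^b| = q^{b-a}` is the modular character of the
upper triangular Borel subgroup. -/
def satakeCoeff (ϖ : Fˣ) (f : GL (Fin 2) F → ℂ) (a b : ℤ) : ℂ :=
  (((q F : ℝ) ^ (((b : ℝ) - a) / 2) : ℝ) : ℂ) * ∫ x, f (torus ϖ a b * unip x) ∂(haarF F)

theorem IsUniformizer.valuation_lt_one {ϖ : Fˣ} (h : IsUniformizer ϖ) :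
    ValuativeRel.valuation F (ϖ : F) < 1 := by
  obtain ⟨p, hp, hm⟩ := h
  have hmem : p ∈ 𝓂[F] := hm ▸ Ideal.mem_span_singleton_self p
  rw [IsLocalRing.mem_maximalIdeal, mem_nonunits_iff,
    (Valuation.integer.integers (ValuativeRel.valuation F)).isUnit_iff_valuation_eq_one] at hmem
  rw [← hp]
  exact lt_of_le_of_ne p.2 hmem

theorem IsUniformizer.exists_bound {ϖ : Fˣ} (h : IsUniformizer ϖ) {S : Set F} (hS : IsCompact S) :
    ∃ N : ℕ, ∀ a : ℤ, (ϖ : F) ^ a ∈ S → -(N : ℤ) ≤ a := by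
  have hv := h.valuation_lt_one
  have h0 : ValuativeRel.valuation F (ϖ : F) ≠ 0 := by simp
  have : MulArchimedean (ValuativeRel.ValueGroupWithZero F) :=
    ValuativeRel.isRankLeOne_iff_mulArchimedean.mp inferInstance
  have hopen : ∀ n : ℕ, IsOpen {x : F | (ϖ : F) ^ n * x ∈ 𝒪[F]} := fun n =>
    (isOpen_integers F).preimage (continuous_const.mul continuous_id)
  obtain ⟨N, hN⟩ := hS.elim_directed_cover _ hopen (by
      intro x _
      obtain ⟨n, hn⟩ := MulArchimedean.arch (ValuativeRel.valuation F x)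
        (y := (ValuativeRel.valuation F (ϖ : F))⁻¹) ((one_lt_inv₀ (zero_lt_iff.mpr h0)).mpr hv)
      refine Set.mem_iUnion.mpr ⟨n, ?_⟩
      change ValuativeRel.valuation F _ ≤ 1
      rw [map_mul, map_pow]
      calc _ ≤ ValuativeRel.valuation F (ϖ : F) ^ n * (ValuativeRel.valuation F (ϖ : F))⁻¹ ^ n := by
            gcongr
        _ = 1 := by rw [← mul_pow, mul_inv_cancel₀ h0, one_pow])
    (directed_of_isDirected_le (by
      intro m n hmn x hx
      change _ ∈ 𝒪[F] at hx
      change _ ∈ 𝒪[F]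
      obtain ⟨k, rfl⟩ := Nat.exists_eq_add_of_le hmn
      rw [pow_add, mul_comm (_ ^ m), mul_assoc]
      exact mul_mem (pow_mem (show (ϖ : F) ∈ 𝒪[F] from hv.le) k) hx))
  refine ⟨N, fun a ha => ?_⟩
  have h1 : ValuativeRel.valuation F ((ϖ : F) ^ N * (ϖ : F) ^ a) ≤ 1 := hN ha
  rw [← zpow_natCast, ← zpow_add₀ ϖ.ne_zero, map_zpow₀] at h1
  by_contra hlt
  have h2 : 1 < ValuativeRel.valuation F (ϖ : F) ^ ((N : ℤ) + a) :=
    one_lt_zpow_of_neg₀ (zero_lt_iff.mpr h0) hv (by omega)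
  exact absurd h1 (not_le.mpr h2)

theorem satakeCoeff_finite {ϖ : Fˣ} (h : IsUniformizer ϖ) (f : heckeAlgebra F) :
    (Function.support fun p : ℤ × ℤ => satakeCoeff ϖ f p.1 p.2).Finite := by
  have hf : IsCompact (tsupport (f : GL (Fin 2) F → ℂ)) := f.2.2.1
  have key : ∀ i : Fin 2, ∃ N : ℕ, ∀ a : ℤ,
      ((∃ g ∈ tsupport (f : GL (Fin 2) F → ℂ), (g : Matrix (Fin 2) (Fin 2) F) i i = (ϖ : F) ^ a) →
        -(N : ℤ) ≤ a) ∧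
      ((∃ g ∈ tsupport (f : GL (Fin 2) F → ℂ),
        ((g⁻¹ : GL (Fin 2) F) : Matrix (Fin 2) (Fin 2) F) i i = (ϖ : F) ^ (-a)) → a ≤ (N : ℤ)) := by
    intro i
    obtain ⟨N, hN⟩ := h.exists_bound (hf.image (Units.continuous_val.matrix_elem i i))
    obtain ⟨M, hM⟩ := h.exists_bound (hf.image
      ((Units.continuous_val.comp (continuous_inv (G := GL (Fin 2) F))).matrix_elem i i))
    refine ⟨max N M, fun a => ⟨?_, ?_⟩⟩
    · rintro ⟨g, hg, hga⟩
      have := hN a ⟨g, hg, hga⟩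
      omega
    · rintro ⟨g, hg, hga⟩
      have := hM (-a) ⟨g, hg, hga⟩
      omega
  obtain ⟨N, hN⟩ := key 0
  obtain ⟨M, hM⟩ := key 1
  refine ((Set.finite_Icc (-(N : ℤ)) N).prod (Set.finite_Icc (-(M : ℤ)) M)).subset ?_
  rintro ⟨a, b⟩ hab
  obtain ⟨x, hx⟩ : ∃ x, (f : GL (Fin 2) F → ℂ) (torus ϖ a b * unip x) ≠ 0 := by
    by_contra! hcon
    exact hab (by simp [satakeCoeff, hcon])
  have hmem := subset_tsupport _ hx
  refine ⟨⟨(hN a).1 ⟨_, hmem, ?_⟩, (hN a).2 ⟨_, hmem, ?_⟩⟩,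
    ⟨(hM b).1 ⟨_, hmem, ?_⟩, (hM b).2 ⟨_, hmem, ?_⟩⟩⟩
  · simp [torus, unip, Matrix.mul_apply]
  · rw [mul_inv_rev]
    simp only [torus, unip, Units.inv_mk, Units.val_mul, Matrix.mul_apply, Fin.sum_univ_two]
    simp
  · simp [torus, unip, Matrix.mul_apply]
  · rw [mul_inv_rev]
    simp only [torus, unip, Units.inv_mk, Units.val_mul, Matrix.mul_apply, Fin.sum_univ_two]
    simp

/-- The Satake transform `𝒮 : C_c^∞(GL₂(F)//K) → ℂ[t₁^{±1}, t₂^{±1}]`. -/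
def satake {ϖ : Fˣ} (h : IsUniformizer ϖ) (f : heckeAlgebra F) : ℂ[ℤ × ℤ] :=
  AddMonoidAlgebra.ofCoeff (Finsupp.ofSupportFinite
    (fun p : ℤ × ℤ => satakeCoeff ϖ f p.1 p.2) (satakeCoeff_finite h f))

/-- The inverse Satake transform `𝒮⁻¹`, used only on elements with a unique `𝒮`-preimage. -/
def satakeInv {ϖ : Fˣ} (h : IsUniformizer ϖ) : ℂ[ℤ × ℤ] → heckeAlgebra F :=
  Function.invFun (satake h)

/-! ### The basic function of `Sym^k` -/

/-- `Sym^j(Sym^k(t₁, t₂))`: the character of `Sym^j(Sym^k V)` at `diag(t₁, t₂)`, that is, the complete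
homogeneous symmetric polynomial of degree `j` in the weights `t₁^{k-i} t₂^i`, `0 ≤ i ≤ k`, of
`Sym^k V`. -/
def symSym (k j : ℕ) : ℂ[ℤ × ℤ] :=
  MvPolynomial.aeval
    (fun i : Fin (k + 1) => (AddMonoidAlgebra.single ((k : ℤ) - (i : ℕ), ((i : ℕ) : ℤ)) 1 : ℂ[ℤ × ℤ]))
    (MvPolynomial.hsymm (Fin (k + 1)) ℂ j)

/-- The basic function `𝕃(Sym^k) = ∑_j 𝒮⁻¹(Sym^j(Sym^k(t₁, t₂)))` on `GL₂(F)`. -/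
def basicFunction {ϖ : Fˣ} (h : IsUniformizer ϖ) (k : ℕ) : GL (Fin 2) F → ℂ :=
  fun g => ∑' j : ℕ, (satakeInv h (symSym k j) : GL (Fin 2) F → ℂ) g

/-- `⌊m/2⌋ - ⌊(m-1)/3⌋`. -/
def floorTerm (m : ℤ) : ℤ := ⌊(m : ℚ) / 2⌋ - ⌊((m : ℚ) - 1) / 3⌋

/-- The Hecke operator `S_j`. In the second sum `s` runs over `0 ≤ s ≤ n - j - 1`. -/
def heckeS (ϖ : Fˣ) (j : ℕ) : GL (Fin 2) F → ℂ :=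
  (∑ n ∈ Finset.Icc 0 (2 * j), ((q F : ℂ) ^ n *
      ∑ s ∈ Finset.Icc 0 (n / 4), (floorTerm ((n : ℤ) - 4 * s) : ℂ)) •
        conv (heckeOne ϖ (4 * j - 2 * n)) (heckeScalar ϖ n)) -
  ∑ n ∈ Finset.Icc (j + 1) (2 * j), ((q F : ℂ) ^ n *
      ∑ s ∈ Finset.Icc 0 (n - j - 1), (floorTerm (s : ℤ) : ℂ)) •
        conv (heckeOne ϖ (4 * j - 2 * n)) (heckeScalar ϖ n)

end

end SatakeGL2

/-!
The coefficient of `t₁^a t₂^b` in `Sym^j(Sym^4(t₁, t₂))` is the number of multisets of `j` elements of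
`{0, …, 4}` with sum `b` (and `a + b = 4j`). The generating function of these numbers is the Gaussian
binomial coefficient `∏_{i=1}^4 (1 - X^{j+i}) / (1 - X^i)` (`sum_sym_pow_mul_prod`). Multiplying it by
`1 - X` and reducing modulo `X^{2j+1}` leaves

  `1 / ((1 - X²)(1 - X³)(1 - X⁴)) - X^{j+1} / ((1 - X)(1 - X²)(1 - X³))`,

whose coefficients are the brackets in `S_j`, since `⌊n/2⌋ - ⌊(n-1)/3⌋` is the coefficient of `X^n` in
`1 / ((1 - X²)(1 - X³))`. So these brackets are the multiplicities of `Sym^{4j-2n} ⊗ det^n` in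
`Sym^j(Sym^4)` (`card_sym_eq_sum_plethysmMult`, `symSym_four_coeff`).

On the group side, `𝟙_m * 𝟙_{i,i}` is the characteristic function of the matrices with entries in
`𝔭^i` and determinant of valuation `m + 2i` (`conv_heckeOne_heckeScalar_apply`), by the Cartan
decomposition. Its Satake transform is therefore computed by the volume of a ball in `F`, and equals
`q^{m/2} h_m(t₁, t₂) (t₁ t₂)^i` (`satakeCoeff_conv`). With `m = 4j - 2n` and `i = n` the powers of `q`
cancel, so `q^{-2j} S_j` is a preimage of `Sym^j(Sym^4(t₁, t₂))` (`satake_normalizedHeckeS`). It is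
the only one because `𝒮` is triangular with respect to the double cosets (`satake_injective`).
Finally `S_j` is supported on the matrices whose determinant has valuation `4j`, so at a given `g` at
most one `j` contributes.
-/

set_option linter.unusedSectionVars false

namespace SatakeGL2

/-! ### Counting multisets of weights -/

section Combinatorics

open MvPolynomial in
theorem aeval_hsymm {σ R A : Type*} [Fintype σ] [DecidableEq σ] [CommSemiring R] [CommSemiring A]
    [Algebra R A] (f : σ → A) (n : ℕ) :
    aeval f (hsymm σ R n) = ∑ s : Sym σ n, (s.1.map f).prod := by
  simp [hsymm, map_sum, ← Multiset.prod_hom']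

theorem sum_sym_zero {α A : Type*} [Fintype α] [DecidableEq α] [CommSemiring A] (f : α → A) :
    ∑ s : Sym α 0, (s.1.map f).prod = 1 := by
  rw [← aeval_hsymm (R := ℕ), MvPolynomial.hsymm_zero, map_one]

theorem sum_sym_option {α A : Type*} [Fintype α] [DecidableEq α] [CommSemiring A]
    (f : Option α → A) (n : ℕ) :
    ∑ s : Sym (Option α) (n + 1), (s.1.map f).prod =
      f none * ∑ s : Sym (Option α) n, (s.1.map f).prod +
        ∑ s : Sym α (n + 1), (s.1.map fun a => f (some a)).prod := by
  rw [← Equiv.sum_comp (symOptionSuccEquiv (α := α) (n := n)).symm, Fintype.sum_sum_type,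
    Finset.mul_sum]
  congr 1
  · refine Finset.sum_congr rfl fun s _ => ?_
    change (Multiset.map f (SymOptionSuccEquiv.decode (Sum.inl s)).1).prod = _
    rw [SymOptionSuccEquiv.decode_inl, Sym.val_eq_coe, Sym.coe_cons]
    simp
  · refine Finset.sum_congr rfl fun s _ => ?_
    change (Multiset.map f (SymOptionSuccEquiv.decode (Sum.inr s)).1).prod = _
    rw [SymOptionSuccEquiv.decode_inr, Sym.val_eq_coe, Sym.coe_map]
    simp

/-- Splitting a multiset of size `n + 1` according to whether it contains the last element:
`h_{n+1}(x₀, …, x_k) = x_k h_n(x₀, …, x_k) + h_{n+1}(x₀, …, x_{k-1})`. -/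
theorem sum_sym_fin_succ {A : Type*} [CommSemiring A] {k : ℕ} (f : Fin (k + 1) → A) (n : ℕ) :
    ∑ s : Sym (Fin (k + 1)) (n + 1), (s.1.map f).prod =
      f (Fin.last k) * ∑ s : Sym (Fin (k + 1)) n, (s.1.map f).prod +
        ∑ s : Sym (Fin k) (n + 1), (s.1.map fun i => f i.castSucc).prod := by
  have key : ∀ m, ∑ s : Sym (Fin (k + 1)) m, (s.1.map f).prod =
      ∑ s : Sym (Option (Fin k)) m, (s.1.map fun o => f (finSuccEquivLast.symm o)).prod := by
    intro m
    refine Fintype.sum_equiv (Sym.equivCongr finSuccEquivLast) _ _ fun s => ?_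
    simp [Sym.equivCongr]
  rw [key, sum_sym_option, key]
  simp

/-- The product formula for the Gaussian binomial coefficient `h_j(1, x, …, x^k)`. -/
theorem sum_sym_pow_mul_prod {A : Type*} [CommRing A] (x : A) (k j : ℕ) :
    (∑ s : Sym (Fin (k + 1)) j, (s.1.map fun i : Fin (k + 1) => x ^ (i : ℕ)).prod) *
      ∏ i ∈ Finset.range k, (1 - x ^ (i + 1)) = ∏ i ∈ Finset.range k, (1 - x ^ (j + i + 1)) := by
  induction k generalizing j with
  | zero =>
    induction j with
    | zero => simp
    | succ j ih =>
      rw [sum_sym_fin_succ]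
      simp
  | succ k ihk =>
    induction j with
    | zero => rw [sum_sym_zero]; simp
    | succ j ih =>
      have h1 := ihk (j + 1)
      have h2 : ∏ i ∈ Finset.range (k + 1), (1 - x ^ (j + i + 1)) =
          (1 - x ^ (j + 1)) * ∏ i ∈ Finset.range k, (1 - x ^ (j + 1 + i + 1)) := by
        rw [Finset.prod_range_succ', mul_comm]
        simp [add_comm, add_left_comm]
      rw [h2] at ih
      rw [sum_sym_fin_succ, add_mul, mul_assoc, ih]
      rw [Finset.prod_range_succ, Finset.prod_range_succ]
      simp only [Fin.val_castSucc, Fin.val_last]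
      rw [← mul_assoc, ← mul_assoc, h1]
      ring

theorem floorTerm_eq (m : ℤ) : floorTerm m = m / 2 - (m - 1) / 3 := by
  have h2 : ⌊(m : ℚ) / 2⌋ = m / 2 := by
    simpa using Int.floor_div_natCast (m : ℚ) 2
  have h3 : ⌊((m : ℚ) - 1) / 3⌋ = (m - 1) / 3 := by
    have := Int.floor_div_natCast (((m - 1 : ℤ) : ℚ)) 3
    rw [Int.floor_intCast] at this
    simpa using this
  rw [floorTerm, h2, h3]

open PowerSeries in
/-- `⌊n/2⌋ - ⌊(n-1)/3⌋` counts the solutions of `2a + 3b = n`. -/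
theorem mk_floorTerm_mul :
    (mk fun n : ℕ => floorTerm n) * ((1 - X ^ 2) * (1 - X ^ 3)) = (1 : ℤ⟦X⟧) := by
  have : (mk fun n : ℕ => floorTerm n) * ((1 - X ^ 2) * (1 - X ^ 3)) =
      (mk fun n : ℕ => floorTerm n) - (mk fun n : ℕ => floorTerm n) * X ^ 2 -
        (mk fun n : ℕ => floorTerm n) * X ^ 3 + (mk fun n : ℕ => floorTerm n) * X ^ 5 := by
    ring
  rw [this]
  ext n
  simp only [map_sub, map_add, coeff_mul_X_pow', coeff_mk, coeff_one, floorTerm_eq]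
  split_ifs <;> omega

/-- The coefficients of `1 / ((1 - X²)(1 - X³)(1 - X⁴))`. -/
def quarterSum (n : ℕ) : ℤ := ∑ s ∈ Finset.Icc 0 (n / 4), floorTerm ((n : ℤ) - 4 * s)

/-- The coefficients of `1 / ((1 - X)(1 - X²)(1 - X³))`. -/
def partialSum (n : ℕ) : ℤ := ∑ s ∈ Finset.Icc 0 n, floorTerm (s : ℤ)

open PowerSeries in
theorem mk_quarterSum_mul :
    (mk quarterSum) * (1 - X ^ 4) = (mk fun n : ℕ => floorTerm n : ℤ⟦X⟧) := by
  rw [mul_sub, mul_one]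
  ext n
  simp only [map_sub, coeff_mul_X_pow', coeff_mk, quarterSum]
  rw [← Nat.range_succ_eq_Icc_zero, Finset.sum_range_succ']
  split_ifs with h
  · rw [← Nat.range_succ_eq_Icc_zero, show (n - 4) / 4 + 1 = n / 4 by omega]
    have : ∀ s ∈ Finset.range (n / 4), floorTerm ((n : ℤ) - 4 * ((s + 1 : ℕ) : ℤ)) =
        floorTerm (((n - 4 : ℕ) : ℤ) - 4 * s) := by
      intro s _
      congr 1
      push_cast [Nat.cast_sub h]
      ring
    rw [Finset.sum_congr rfl this]
    simp
  · rw [show n / 4 = 0 by omega]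
    simp

open PowerSeries in
theorem mk_partialSum_mul :
    (mk partialSum) * (1 - X) = (mk fun n : ℕ => floorTerm n : ℤ⟦X⟧) := by
  rw [mul_sub, mul_one]
  ext n
  cases n with
  | zero => simp [partialSum]
  | succ n =>
    simp only [map_sub, coeff_succ_mul_X, coeff_mk, partialSum]
    rw [← Nat.range_succ_eq_Icc_zero, ← Nat.range_succ_eq_Icc_zero, Finset.sum_range_succ]
    simp

/-- The multiplicity of `Sym^{4j-2n} ⊗ det^n` in `Sym^j(Sym^4)`, for `n ≤ 2j`. -/
def plethysmMult (j n : ℕ) : ℤ :=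
  quarterSum n - if j + 1 ≤ n then partialSum (n - j - 1) else 0

open PowerSeries in
/-- The weight multiplicities of `Sym^j(Sym^4)` up to the middle weight are the partial sums of the
plethysm multiplicities. -/
theorem card_sym_eq_sum_plethysmMult {j b : ℕ} (hb : b ≤ 2 * j) :
    (({s : Sym (Fin 5) j | (s.1.map fun i : Fin 5 => (i : ℕ)).sum = b} : Finset _).card : ℤ) =
      ∑ n ∈ Finset.range (b + 1), plethysmMult j n := by
  set G : ℤ⟦X⟧ := ∑ s : Sym (Fin 5) j, (s.1.map fun i : Fin 5 => (X : ℤ⟦X⟧) ^ (i : ℕ)).prod with hG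
  have hcoeff : coeff b G =
      (({s : Sym (Fin 5) j | (s.1.map fun i : Fin 5 => (i : ℕ)).sum = b} : Finset _).card : ℤ) := by
    rw [hG, map_sum, Finset.card_filter, Nat.cast_sum]
    refine Finset.sum_congr rfl fun s _ => ?_
    have : (s.1.map fun i : Fin 5 => (X : ℤ⟦X⟧) ^ (i : ℕ)).prod =
        X ^ (s.1.map fun i : Fin 5 => (i : ℕ)).sum := by
      induction s.1 using Multiset.induction_on with
      | empty => simp
      | cons a t ih => simp [ih, pow_add]
    rw [this, coeff_X_pow, Nat.cast_ite, Nat.cast_one, Nat.cast_zero]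
    exact if_congr eq_comm rfl rfl
  have hprod := sum_sym_pow_mul_prod (X : ℤ⟦X⟧) 4 j
  rw [← hG] at hprod
  simp only [Finset.prod_range_succ, Finset.prod_range_zero] at hprod
  set A : ℤ⟦X⟧ := mk quarterSum
  set B : ℤ⟦X⟧ := mk partialSum
  set T : ℤ⟦X⟧ := mk fun n : ℕ => floorTerm n
  have hA : A * (1 - X ^ 4) = T := mk_quarterSum_mul
  have hB : B * (1 - X) = T := mk_partialSum_mul
  have hT : T * ((1 - X ^ 2) * (1 - X ^ 3)) = 1 := mk_floorTerm_mul
  have hne : (1 - X : ℤ⟦X⟧) ≠ 0 := fun h => by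
    have := congrArg (coeff 0) h
    simp at this
  have hAB : (1 + X + X ^ 2 + X ^ 3) * A = B := by
    apply mul_right_cancel₀ hne
    rw [hB, ← hA]
    ring
  -- `X^{2j+1} C` collects the terms of `∏ (1 - X^{j+i})` beyond the middle degree.
  obtain ⟨C, hC⟩ : ∃ C : ℤ⟦X⟧, G * (1 - X) = A - X ^ (j + 1) * B + X ^ (2 * j + 1) * C := by
    refine ⟨((X ^ 2 + X ^ 3 + 2 * X ^ 4 + X ^ 5 + X ^ 6)
      - X ^ (j + 1) * (X ^ 4 + X ^ 5 + X ^ 6 + X ^ 7) + X ^ (2 * j + 9)) * A, ?_⟩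
    have e : G * (1 - X) =
        G * (1 * (1 - X ^ (0 + 1)) * (1 - X ^ (1 + 1)) * (1 - X ^ (2 + 1)) * (1 - X ^ (3 + 1))) *
          A := by
      calc G * (1 - X) = G * (1 - X) * (T * ((1 - X ^ 2) * (1 - X ^ 3))) := by rw [hT, mul_one]
        _ = _ := by rw [← hA]; ring
    rw [e, hprod, ← hAB]
    ring
  -- Multiplying by `1 / (1 - X)` turns coefficients into partial sums.
  have hmk : G = G * (1 - X) * mk 1 := by
    rw [mul_assoc, mul_comm (1 - X), mk_one_mul_one_sub_eq_one, mul_one]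
  rw [← hcoeff, hmk, coeff_mul, Finset.Nat.sum_antidiagonal_eq_sum_range_succ_mk]
  refine Finset.sum_congr rfl fun n hn => ?_
  have hn' : ¬ 2 * j + 1 ≤ n := by
    have := Finset.mem_range.mp hn
    omega
  rw [hC]
  simp only [map_add, map_sub, coeff_X_pow_mul', coeff_mk, Pi.one_apply, mul_one, hn', if_false,
    add_zero, plethysmMult, A, B, Nat.sub_sub]

/-- The symmetry of the weight multiplicities under `i ↦ 4 - i`. -/
theorem card_sym_rev (j b : ℕ) (hb : b ≤ 4 * j) :
    ({s : Sym (Fin 5) j | (s.1.map fun i : Fin 5 => (i : ℕ)).sum = b} : Finset _).card =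
      ({s : Sym (Fin 5) j | (s.1.map fun i : Fin 5 => (i : ℕ)).sum = 4 * j - b} : Finset _).card := by
  have key : ∀ s : Sym (Fin 5) j,
      ((Sym.equivCongr Fin.revPerm s).1.map fun i : Fin 5 => (i : ℕ)).sum +
      (s.1.map fun i : Fin 5 => (i : ℕ)).sum = 4 * j := by
    intro s
    have : ∀ t : Multiset (Fin 5), ((t.map Fin.rev).map fun i : Fin 5 => (i : ℕ)).sum +
        (t.map fun i : Fin 5 => (i : ℕ)).sum = 4 * t.card := by
      intro t
      induction t using Multiset.induction_on with
      | empty => simp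
      | cons a t ih =>
        simp only [Multiset.map_cons, Multiset.sum_cons, Multiset.card_cons, Fin.val_rev] at ih ⊢
        omega
    have h := this s.1
    rw [s.2] at h
    exact h
  refine Finset.card_equiv (Sym.equivCongr Fin.revPerm) fun s => ?_
  have := key s
  simp only [Finset.mem_filter, Finset.mem_univ, true_and]
  omega

/-- The coefficient of `t₁^a t₂^b` in `Sym^j(Sym^4(t₁, t₂))`. -/
theorem symSym_four_coeff (j : ℕ) (a b : ℤ) :
    (symSym 4 j).coeff (a, b) =
      if a + b = 4 * j then
        ((∑ n ∈ (Finset.Icc 0 (2 * j)).filter fun n : ℕ => (n : ℤ) ≤ a ∧ (n : ℤ) ≤ b,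
          plethysmMult j n : ℤ) : ℂ)
      else 0 := by
  have hs : ∀ s : Sym (Fin 5) j,
      (s.1.map fun i : Fin 5 => (AddMonoidAlgebra.single
        (((4 : ℕ) : ℤ) - (i : ℕ), ((i : ℕ) : ℤ)) 1 : ℂ[ℤ × ℤ])).prod =
        AddMonoidAlgebra.single ((4 * j : ℤ) - (s.1.map fun i : Fin 5 => (i : ℕ)).sum,
          ((s.1.map fun i : Fin 5 => (i : ℕ)).sum : ℤ)) 1 := by
    intro s
    have : ∀ t : Multiset (Fin 5),
      (t.map fun i : Fin 5 => (AddMonoidAlgebra.single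
        (((4 : ℕ) : ℤ) - (i : ℕ), ((i : ℕ) : ℤ)) 1 : ℂ[ℤ × ℤ])).prod =
        AddMonoidAlgebra.single ((4 * t.card : ℤ) - (t.map fun i : Fin 5 => (i : ℕ)).sum,
          ((t.map fun i : Fin 5 => (i : ℕ)).sum : ℤ)) 1 := by
      intro t
      induction t using Multiset.induction_on with
      | empty =>
        simp only [Multiset.map_zero, Multiset.prod_zero, Multiset.sum_zero, Multiset.card_zero]
        rfl
      | cons a t ih =>
        rw [Multiset.map_cons, Multiset.prod_cons, ih, AddMonoidAlgebra.single_mul_single]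
        congr 1
        · ext
          · simp
            ring
          · simp
        · simp
    have h := this s.1
    rwa [s.2] at h
  have hle : ∀ s : Sym (Fin 5) j, (s.1.map fun i : Fin 5 => (i : ℕ)).sum ≤ 4 * j := by
    intro s
    have := Multiset.sum_le_card_nsmul (s.1.map fun i : Fin 5 => (i : ℕ)) 4 (by
      intro x hx
      obtain ⟨i, -, rfl⟩ := Multiset.mem_map.mp hx
      omega)
    rw [Multiset.card_map, s.2, smul_eq_mul] at this
    omega
  have hcoeff : (symSym 4 j).coeff (a, b) = ∑ s : Sym (Fin 5) j,
      if ((4 * j : ℤ) - (s.1.map fun i : Fin 5 => (i : ℕ)).sum = a ∧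
        ((s.1.map fun i : Fin 5 => (i : ℕ)).sum : ℤ) = b) then (1 : ℂ) else 0 := by
    rw [symSym, aeval_hsymm, Finset.sum_congr rfl fun s _ => hs s, AddMonoidAlgebra.coeff_sum,
      Finsupp.finsetSum_apply]
    refine Finset.sum_congr rfl fun s _ => ?_
    rw [AddMonoidAlgebra.coeff_single, Finsupp.single_apply]
    simp only [Prod.mk.injEq]
  rw [hcoeff]
  split_ifs with hab
  · have hcard : ∀ c : ℕ, (c : ℤ) = b → (∑ s : Sym (Fin 5) j,
        if ((4 * j : ℤ) - (s.1.map fun i : Fin 5 => (i : ℕ)).sum = a ∧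
        ((s.1.map fun i : Fin 5 => (i : ℕ)).sum : ℤ) = b) then (1 : ℂ) else 0) =
        (((({s : Sym (Fin 5) j | (s.1.map fun i : Fin 5 => (i : ℕ)).sum = c} :
          Finset _).card : ℤ)) : ℂ) := by
      intro c hc
      rw [Finset.card_filter, Nat.cast_sum, Int.cast_sum]
      refine Finset.sum_congr rfl fun s _ => ?_
      have : ((4 * j : ℤ) - (s.1.map fun i : Fin 5 => (i : ℕ)).sum = a ∧
          ((s.1.map fun i : Fin 5 => (i : ℕ)).sum : ℤ) = b) ↔
          (s.1.map fun i : Fin 5 => (i : ℕ)).sum = c := by omega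
      simp only [this]
      split_ifs <;> simp
    -- For a negative exponent both sides are empty; past the middle weight `2j`, the symmetry
    -- `b ↦ 4j - b` applies.
    by_cases h0 : 0 ≤ b ∧ 0 ≤ a
    · obtain ⟨c, hc⟩ := Int.eq_ofNat_of_zero_le h0.1
      rw [hcard c hc.symm, Int.cast_inj]
      obtain h | h := le_total c (2 * j)
      · rw [card_sym_eq_sum_plethysmMult h]
        refine Finset.sum_congr ?_ fun _ _ => rfl
        ext n
        simp only [Finset.mem_range, Finset.mem_filter, Finset.mem_Icc]
        omega
      · rw [card_sym_rev j c (by omega), card_sym_eq_sum_plethysmMult (by omega)]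
        refine Finset.sum_congr ?_ fun _ _ => rfl
        ext n
        simp only [Finset.mem_range, Finset.mem_filter, Finset.mem_Icc]
        omega
    · rw [Finset.filter_eq_empty_iff.mpr (fun n _ => by omega), Finset.sum_empty, Int.cast_zero]
      refine Finset.sum_eq_zero fun s _ => if_neg ?_
      have := hle s
      omega
  · exact Finset.sum_eq_zero fun s _ => if_neg (by omega)

end Combinatorics

/-! ### Valuations and volumes in a local field -/

section LocalField

variable {F : Type*} [Field F] [ValuativeRel F] [TopologicalSpace F] [IsNonarchimedeanLocalField F]

open ValuativeRel (valuation)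

theorem IsUniformizer.zpow_le_zpow_iff {ϖ : Fˣ} (h : IsUniformizer ϖ) {a b : ℤ} :
    valuation F (ϖ : F) ^ a ≤ valuation F (ϖ : F) ^ b ↔ b ≤ a :=
  zpow_le_zpow_iff_right_of_lt_one₀ (zero_lt_iff.mpr (by simp)) h.valuation_lt_one

theorem IsUniformizer.zpow_inj {ϖ : Fˣ} (h : IsUniformizer ϖ) {a b : ℤ} :
    valuation F (ϖ : F) ^ a = valuation F (ϖ : F) ^ b ↔ a = b := by
  simp only [le_antisymm_iff, h.zpow_le_zpow_iff, and_comm]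

theorem IsUniformizer.exists_valuation_eq {ϖ : Fˣ} (h : IsUniformizer ϖ) {x : F} (hx : x ≠ 0) :
    ∃ k : ℤ, valuation F x = valuation F (ϖ : F) ^ k := by
  have integral : ∀ y : F, y ≠ 0 → valuation F y ≤ 1 →
      ∃ k : ℤ, valuation F y = valuation F (ϖ : F) ^ k := by
    intro y hy hy1
    obtain ⟨p, hp, hm⟩ := h
    have hp0 : p ≠ 0 := by
      rintro rfl
      exact ϖ.ne_zero hp.symm
    have hirr : Irreducible p := (IsDiscreteValuationRing.irreducible_iff_uniformizer p).mpr hm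
    obtain ⟨n, u, hu⟩ := IsDiscreteValuationRing.eq_unit_mul_pow_irreducible
      (x := (⟨y, hy1⟩ : 𝒪[F])) (by simpa [Subtype.ext_iff] using hy) hirr
    have hu1 : valuation F (((u : 𝒪[F]) : F)) = 1 :=
      (Valuation.integer.integers (valuation F)).isUnit_iff_valuation_eq_one.mp u.isUnit
    refine ⟨n, ?_⟩
    have : y = ((u : 𝒪[F]) : F) * (p : F) ^ n := by simpa using congrArg Subtype.val hu
    rw [this, map_mul, hu1, one_mul, map_pow, hp, zpow_natCast]
  obtain h1 | h1 := le_total (valuation F x) 1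
  · exact integral x hx h1
  · obtain ⟨k, hk⟩ := integral x⁻¹ (inv_ne_zero hx) (by
      rw [map_inv₀]
      exact inv_le_one_of_one_le₀ h1)
    exact ⟨-k, by rw [zpow_neg, ← hk, map_inv₀, inv_inv]⟩

theorem IsUniformizer.residue_eq_iff {ϖ : Fˣ} (h : IsUniformizer ϖ) (x y : 𝒪[F]) :
    IsLocalRing.residue 𝒪[F] x = IsLocalRing.residue 𝒪[F] y ↔
      valuation F ((x : F) - y) ≤ valuation F (ϖ : F) := by
  obtain ⟨p, hp, hm⟩ := h
  rw [← sub_eq_zero, ← map_sub, IsLocalRing.residue_eq_zero_iff, hm, Ideal.mem_span_singleton,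
    (Valuation.integer.integers (valuation F)).dvd_iff_le, ← hp]
  rfl

theorem one_lt_q : 1 < q F := by
  rw [q, Finite.one_lt_card_iff_nontrivial]
  infer_instance

open scoped Pointwise in
theorem smul_ball (c : Fˣ) (γ : ValuativeRel.ValueGroupWithZero F) :
    c • {x : F | valuation F x ≤ γ} = {x : F | valuation F x ≤ valuation F (c : F) * γ} := by
  ext x
  rw [Set.mem_smul_set_iff_inv_smul_mem]
  simp only [Set.mem_ofPred_eq, Units.smul_def, smul_eq_mul, map_mul, Units.val_inv_eq_inv_val,
    map_inv₀]
  rw [inv_mul_le_iff₀ (zero_lt_iff.mpr (by simp))]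

open scoped Pointwise in
/-- The Haar measure of a ball. Multiplication by `ϖ` scales Haar measures by a constant, which is
`q⁻¹` because `𝔬` is the disjoint union of `q` translates of `ϖ𝔬`. -/
theorem haarF_ball {ϖ : Fˣ} (h : IsUniformizer ϖ) (k : ℤ) :
    (haarF F).real {x : F | valuation F x ≤ valuation F (ϖ : F) ^ k} = (q F : ℝ) ^ (-k) := by
  let _ : MeasurableSpace F := borel F
  have : BorelSpace F := ⟨rfl⟩
  have := t2Space F
  let 𝒦 : TopologicalSpace.PositiveCompacts F := ⟨⟨(𝒪[F] : Set F), isCompact_integers F⟩,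
      ⟨0, by rw [(isOpen_integers F).interior_eq]; exact zero_mem 𝒪[F]⟩⟩
  have hself : haarF F {x : F | valuation F x ≤ 1} = 1 :=
    MeasureTheory.Measure.addHaarMeasure_self (K₀ := 𝒦)
  have : (haarF F).IsAddHaarMeasure :=
    MeasureTheory.Measure.isAddHaarMeasure_addHaarMeasure 𝒦
  have : (haarF F).Regular := MeasureTheory.Measure.regular_addHaarMeasure
  have hscale : ∀ (g : Fˣ), haarF F {x : F | valuation F x ≤ valuation F (g : F)} =
      MeasureTheory.distribHaarChar F g := by
    intro g
    have h1 := MeasureTheory.distribHaarChar_mul (haarF F) g {x : F | valuation F x ≤ 1}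
    rw [hself, mul_one, smul_ball, mul_one] at h1
    exact h1.symm
  -- The partition of `𝔬` into residue classes.
  have hmeas : ∀ γ : ValuativeRel.ValueGroupWithZero F,
      MeasurableSet {x : F | valuation F x ≤ γ} := fun γ =>
    (IsNonarchimedeanLocalField.isCompact_closedBall F γ).measurableSet
  have hq : (1 : ENNReal) = q F * MeasureTheory.distribHaarChar F ϖ := by
    choose r hr using IsLocalRing.residue_surjective (R := 𝒪[F])
    have hU : {x : F | valuation F x ≤ 1} =
        ⋃ c : 𝓀[F], ((r c : F) +ᵥ {x : F | valuation F x ≤ valuation F (ϖ : F)}) := by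
      ext x
      simp only [Set.mem_iUnion, Set.mem_vadd_set_iff_neg_vadd_mem, vadd_eq_add, Set.mem_ofPred_eq,
        neg_add_eq_sub]
      constructor
      · intro hx
        refine ⟨IsLocalRing.residue 𝒪[F] ⟨x, hx⟩, ?_⟩
        exact (h.residue_eq_iff ⟨x, hx⟩ _).mp (hr _).symm
      · rintro ⟨c, hc⟩
        have := (valuation F).map_add (x - r c) (r c)
        rw [sub_add_cancel] at this
        exact this.trans (max_le (hc.trans h.valuation_lt_one.le) (r c).2)
    rw [← hself, hU, MeasureTheory.measure_iUnion]
    · simp only [MeasureTheory.measure_vadd, hscale, ENNReal.tsum_const, q]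
      congr 1
      rw [ENat.card_eq_coe_natCard]
      rfl
    · intro c d hcd
      refine Set.disjoint_left.mpr fun x hx hx' => hcd ?_
      simp only [Set.mem_vadd_set_iff_neg_vadd_mem, vadd_eq_add, Set.mem_ofPred_eq,
        neg_add_eq_sub] at hx hx'
      rw [← hr c, ← hr d, h.residue_eq_iff]
      have := (valuation F).map_sub (x - r d) (x - r c)
      rw [sub_sub_sub_cancel_left] at this
      exact this.trans (max_le hx' hx)
    · exact fun c => (hmeas _).const_vadd _
  have hδ : (MeasureTheory.distribHaarChar F ϖ : ℝ) = (q F : ℝ)⁻¹ := by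
    have h2 := congrArg ENNReal.toReal hq
    simp only [ENNReal.toReal_one, ENNReal.toReal_mul, ENNReal.toReal_natCast,
      ENNReal.coe_toReal] at h2
    exact eq_inv_of_mul_eq_one_right h2.symm
  have h3 := hscale (ϖ ^ k)
  rw [Units.val_zpow_eq_zpow_val, map_zpow₀] at h3
  rw [MeasureTheory.measureReal_def, h3, ENNReal.coe_toReal, map_zpow, NNReal.coe_zpow, hδ,
    inv_zpow, zpow_neg]

theorem integral_indicator_ball {ϖ : Fˣ} (h : IsUniformizer ϖ) (k : ℤ) (c : ℂ) :
    ∫ x, {x : F | valuation F x ≤ valuation F (ϖ : F) ^ k}.indicator (fun _ => c) x ∂(haarF F) =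
      (q F : ℂ) ^ (-k) * c := by
  let _ : MeasurableSpace F := borel F
  have : BorelSpace F := ⟨rfl⟩
  have := t2Space F
  rw [MeasureTheory.integral_indicator_const _
    (IsNonarchimedeanLocalField.isCompact_closedBall F _).measurableSet, haarF_ball h]
  simp

end LocalField

/-! ### The Cartan decomposition -/

section Cartan

variable {F : Type*} [Field F] [ValuativeRel F] [TopologicalSpace F] [IsNonarchimedeanLocalField F]

open ValuativeRel (valuation)

/-- The largest valuation of an entry of `g`. -/
noncomputable def height (g : GL (Fin 2) F) : ValuativeRel.ValueGroupWithZero F :=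
  Finset.univ.sup fun p : Fin 2 × Fin 2 => valuation F ((g : Matrix (Fin 2) (Fin 2) F) p.1 p.2)

theorem height_le_iff {g : GL (Fin 2) F} {γ : ValuativeRel.ValueGroupWithZero F} :
    height g ≤ γ ↔ ∀ i j, valuation F ((g : Matrix (Fin 2) (Fin 2) F) i j) ≤ γ := by
  simp [height]

theorem valuation_le_height (g : GL (Fin 2) F) (i j : Fin 2) :
    valuation F ((g : Matrix (Fin 2) (Fin 2) F) i j) ≤ height g :=
  height_le_iff.mp le_rfl i j

theorem valuation_det_of_mem {k : GL (Fin 2) F} (hk : k ∈ maxCompact F) :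
    valuation F (k : Matrix (Fin 2) (Fin 2) F).det = 1 := by
  obtain ⟨k, rfl⟩ := hk
  have h := (Matrix.isUnits_det_units k)
  have h1 := (Valuation.integer.integers (valuation F)).isUnit_iff_valuation_eq_one.mp h
  rw [← h1]
  congr 1

theorem mem_maxCompact_of {k : GL (Fin 2) F} (h : height k ≤ 1)
    (hdet : valuation F (k : Matrix (Fin 2) (Fin 2) F).det = 1) : k ∈ maxCompact F := by
  rw [mem_maxCompact_iff]
  have h' := height_le_iff.mp h
  refine fun i j => ⟨h' i j, ?_⟩
  change valuation F _ ≤ 1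
  rw [Matrix.coe_units_inv, Matrix.inv_def, Matrix.smul_apply, smul_eq_mul, map_mul,
    Ring.inverse_eq_inv', map_inv₀, hdet, inv_one, one_mul, Matrix.adjugate_fin_two]
  fin_cases i <;> fin_cases j <;> simp [h']

theorem height_mul_le (g h : GL (Fin 2) F) : height (g * h) ≤ height g * height h := by
  rw [height_le_iff]
  intro i j
  rw [Units.val_mul, Matrix.mul_apply]
  refine Valuation.map_sum_le _ fun l _ => ?_
  rw [map_mul]
  exact mul_le_mul' (valuation_le_height g i l) (valuation_le_height h l j)

theorem height_le_one_of_mem {k : GL (Fin 2) F} (hk : k ∈ maxCompact F) : height k ≤ 1 :=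
  height_le_iff.mpr fun i j => ((mem_maxCompact_iff F k).mp hk i j).1

theorem height_mul_left {k : GL (Fin 2) F} (hk : k ∈ maxCompact F) (g : GL (Fin 2) F) :
    height (k * g) = height g := by
  have key : ∀ k ∈ maxCompact F, ∀ g : GL (Fin 2) F, height (k * g) ≤ height g := fun k hk g =>
    (height_mul_le k g).trans (mul_le_of_le_one_left' (height_le_one_of_mem hk))
  refine le_antisymm (key k hk g) ?_
  simpa using key k⁻¹ (inv_mem hk) (k * g)

theorem height_mul_right {k : GL (Fin 2) F} (hk : k ∈ maxCompact F) (g : GL (Fin 2) F) :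
    height (g * k) = height g := by
  have key : ∀ k ∈ maxCompact F, ∀ g : GL (Fin 2) F, height (g * k) ≤ height g := fun k hk g =>
    (height_mul_le g k).trans (mul_le_of_le_one_right' (height_le_one_of_mem hk))
  refine le_antisymm (key k hk g) ?_
  simpa using key k⁻¹ (inv_mem hk) (g * k)

theorem det_torus (ϖ : Fˣ) (a b : ℤ) :
    (torus ϖ a b : Matrix (Fin 2) (Fin 2) F).det = (ϖ : F) ^ (a + b) := by
  simp [torus, Matrix.det_fin_two, zpow_add₀]

theorem height_torus {ϖ : Fˣ} (h : IsUniformizer ϖ) {a b : ℤ} (hab : b ≤ a) :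
    height (torus ϖ a b) = valuation F (ϖ : F) ^ b := by
  apply le_antisymm
  · rw [height_le_iff]
    intro i j
    fin_cases i <;> fin_cases j <;> simp [torus, h.zpow_le_zpow_iff, hab]
  · simpa [torus] using valuation_le_height (torus ϖ a b) 1 1

/-- Gaussian elimination, when the entry of largest valuation is at the bottom right. -/
theorem exists_mul_eq_torus_of_le {ϖ : Fˣ} (h : IsUniformizer ϖ) (g : GL (Fin 2) F)
    (hg : height g ≤ valuation F ((g : Matrix (Fin 2) (Fin 2) F) 1 1)) :
    ∃ k₁ ∈ maxCompact F, ∃ k₂ ∈ maxCompact F, ∃ a b : ℤ, b ≤ a ∧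
      k₁ * g * k₂ = torus ϖ a b := by
  set M : Matrix (Fin 2) (Fin 2) F := (g : Matrix (Fin 2) (Fin 2) F) with hM
  rw [height_le_iff] at hg
  have hdet : M.det ≠ 0 := (Matrix.isUnits_det_units g).ne_zero
  have hδ : M 1 1 ≠ 0 := by
    intro h0
    rw [h0, map_zero] at hg
    have hz : ∀ i j, M i j = 0 := fun i j => by simpa using hg i j
    exact hdet (by simp [Matrix.det_fin_two, hz])
  have hδv : 0 < valuation F (M 1 1) := zero_lt_iff.mpr (by simpa using hδ)
  obtain ⟨b, hb⟩ := h.exists_valuation_eq hδ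
  set D : F := M.det / M 1 1 with hDdef
  have hD0 : D ≠ 0 := div_ne_zero hdet hδ
  obtain ⟨a, ha⟩ := h.exists_valuation_eq hD0
  have hDle : valuation F D ≤ valuation F (M 1 1) := by
    rw [hDdef, map_div₀, div_le_iff₀ hδv, Matrix.det_fin_two]
    refine ((valuation F).map_sub _ _).trans (max_le ?_ ?_)
    · rw [map_mul]
      exact mul_le_mul' (hg 0 0) le_rfl
    · rw [map_mul]
      exact mul_le_mul' (hg 0 1) (hg 1 0)
  have hab : b ≤ a := by rwa [ha, hb, h.zpow_le_zpow_iff] at hDle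
  have hϖ0 : ∀ c : ℤ, (ϖ : F) ^ c ≠ 0 := fun c => zpow_ne_zero c ϖ.ne_zero
  have hva : valuation F ((ϖ : F) ^ a / D) = 1 := by
    rw [map_div₀, map_zpow₀, ha, div_self (by simp [zpow_ne_zero])]
  have hvb : valuation F ((ϖ : F) ^ b / M 1 1) = 1 := by
    rw [map_div₀, map_zpow₀, hb, div_self (by simp [zpow_ne_zero])]
  have hquot : ∀ i j, valuation F (M i j / M 1 1) ≤ 1 := fun i j => by
    rw [map_div₀]
    exact div_le_one_of_le₀ (hg i j) (zero_le)
  let L : Matrix (Fin 2) (Fin 2) F :=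
    !![(ϖ : F) ^ a / D, -((ϖ : F) ^ a / D) * (M 0 1 / M 1 1); 0, (ϖ : F) ^ b / M 1 1]
  let R : Matrix (Fin 2) (Fin 2) F := !![1, 0; -(M 1 0 / M 1 1), 1]
  have hLdet : L.det = (ϖ : F) ^ a / D * ((ϖ : F) ^ b / M 1 1) := by
    simp [L, Matrix.det_fin_two]
  have hRdet : R.det = 1 := by simp [R, Matrix.det_fin_two]
  refine ⟨Matrix.GeneralLinearGroup.mkOfDetNeZero L ?_, mem_maxCompact_of ?_ ?_,
    Matrix.GeneralLinearGroup.mkOfDetNeZero R ?_, mem_maxCompact_of ?_ ?_, a, b, hab, ?_⟩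
  · rw [hLdet]
    exact mul_ne_zero (div_ne_zero (hϖ0 a) hD0) (div_ne_zero (hϖ0 b) hδ)
  · rw [height_le_iff]
    intro i j
    change valuation F (L i j) ≤ 1
    fin_cases i <;> fin_cases j
    · exact hva.le
    · change valuation F (-((ϖ : F) ^ a / D) * (M 0 1 / M 1 1)) ≤ 1
      rw [map_mul, Valuation.map_neg, hva, one_mul]
      exact hquot 0 1
    · simp [L]
    · exact hvb.le
  · change valuation F L.det = 1
    rw [hLdet, map_mul, hva, hvb, one_mul]
  · rw [hRdet]
    exact one_ne_zero
  · rw [height_le_iff]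
    intro i j
    change valuation F (R i j) ≤ 1
    fin_cases i <;> fin_cases j
    · simp [R]
    · simp [R]
    · change valuation F (-(M 1 0 / M 1 1)) ≤ 1
      rw [Valuation.map_neg]
      exact hquot 1 0
    · simp [R]
  · change valuation F R.det = 1
    rw [hRdet, map_one]
  · apply Units.ext
    change L * M * R = !![(ϖ : F) ^ a, 0; 0, (ϖ : F) ^ b]
    have hDM : D * M 1 1 = M 0 0 * M 1 1 - M 0 1 * M 1 0 := by
      rw [hDdef, div_mul_cancel₀ _ hδ, Matrix.det_fin_two]
    ext i j
    fin_cases i <;> fin_cases j <;>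
      simp only [L, R, Matrix.mul_apply, Fin.sum_univ_two, Matrix.of_apply, Matrix.cons_val',
        Matrix.cons_val_zero, Matrix.cons_val_one, Matrix.cons_val_fin_one, Fin.zero_eta,
        Fin.mk_one, Fin.isValue] <;> field_simp
    · linear_combination (-1 : F) * hDM
    all_goals ring

/-- The Weyl element. -/
noncomputable def weyl : GL (Fin 2) F := Matrix.GeneralLinearGroup.mkOfDetNeZero !![0, 1; 1, 0]
  (by simp [Matrix.det_fin_two])

theorem weyl_mem : (weyl : GL (Fin 2) F) ∈ maxCompact F := by
  refine mem_maxCompact_of (height_le_iff.mpr fun i j => ?_) ?_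
  · change valuation F ((!![0, 1; 1, 0] : Matrix (Fin 2) (Fin 2) F) i j) ≤ 1
    fin_cases i <;> fin_cases j <;> simp
  · change valuation F (!![0, 1; 1, 0] : Matrix (Fin 2) (Fin 2) F).det = 1
    simp [Matrix.det_fin_two]

theorem weyl_mul_apply (g : GL (Fin 2) F) (j : Fin 2) :
    ((weyl * g : GL (Fin 2) F) : Matrix (Fin 2) (Fin 2) F) 1 j =
      (g : Matrix (Fin 2) (Fin 2) F) 0 j := by
  rw [Units.val_mul]
  change ((!![0, 1; 1, 0] : Matrix (Fin 2) (Fin 2) F) * (g : Matrix (Fin 2) (Fin 2) F)) 1 j = _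
  simp [Matrix.mul_apply]

theorem mul_weyl_apply (g : GL (Fin 2) F) (i : Fin 2) :
    ((g * weyl : GL (Fin 2) F) : Matrix (Fin 2) (Fin 2) F) i 1 =
      (g : Matrix (Fin 2) (Fin 2) F) i 0 := by
  rw [Units.val_mul]
  change ((g : Matrix (Fin 2) (Fin 2) F) * (!![0, 1; 1, 0] : Matrix (Fin 2) (Fin 2) F)) i 1 = _
  simp [Matrix.mul_apply]

theorem exists_mul_eq_torus {ϖ : Fˣ} (h : IsUniformizer ϖ) (g : GL (Fin 2) F) :
    ∃ k₁ ∈ maxCompact F, ∃ k₂ ∈ maxCompact F, ∃ a b : ℤ, b ≤ a ∧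
      k₁ * g * k₂ = torus ϖ a b := by
  have col : ∀ g : GL (Fin 2) F,
      (∃ i, height g ≤ valuation F ((g : Matrix (Fin 2) (Fin 2) F) i 1)) →
      ∃ k₁ ∈ maxCompact F, ∃ k₂ ∈ maxCompact F, ∃ a b : ℤ, b ≤ a ∧ k₁ * g * k₂ = torus ϖ a b := by
    rintro g ⟨i, hi⟩
    fin_cases i
    · obtain ⟨k₁, hk₁, k₂, hk₂, a, b, hab, e⟩ := exists_mul_eq_torus_of_le h (weyl * g) (by
        rw [height_mul_left weyl_mem, weyl_mul_apply]
        exact hi)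
      exact ⟨k₁ * weyl, mul_mem hk₁ weyl_mem, k₂, hk₂, a, b, hab, by rw [← e, mul_assoc k₁]⟩
    · exact exists_mul_eq_torus_of_le h g hi
  obtain ⟨⟨i, j⟩, -, hij⟩ := Finset.exists_mem_eq_sup (Finset.univ : Finset (Fin 2 × Fin 2))
    Finset.univ_nonempty
    fun p => valuation F ((g : Matrix (Fin 2) (Fin 2) F) p.1 p.2)
  change height g = valuation F ((g : Matrix (Fin 2) (Fin 2) F) i j) at hij
  fin_cases j
  · obtain ⟨k₁, hk₁, k₂, hk₂, a, b, hab, e⟩ := col (g * weyl) ⟨i, by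
      rw [height_mul_right weyl_mem, mul_weyl_apply]
      exact hij.le⟩
    exact ⟨k₁, hk₁, weyl * k₂, mul_mem weyl_mem hk₂, a, b, hab, by rw [← e]; group⟩
  · exact col g ⟨i, hij.le⟩

theorem valuation_det_mul_mul {k₁ k₂ : GL (Fin 2) F} (hk₁ : k₁ ∈ maxCompact F)
    (hk₂ : k₂ ∈ maxCompact F) (g : GL (Fin 2) F) :
    valuation F ((k₁ * g * k₂ : GL (Fin 2) F) : Matrix (Fin 2) (Fin 2) F).det =
      valuation F (g : Matrix (Fin 2) (Fin 2) F).det := by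
  simp [valuation_det_of_mem hk₁, valuation_det_of_mem hk₂]

/-- The Cartan decomposition, together with the invariants that determine the exponents. -/
theorem cartan_decomposition {ϖ : Fˣ} (h : IsUniformizer ϖ) (g : GL (Fin 2) F) :
    ∃ k₁ ∈ maxCompact F, ∃ k₂ ∈ maxCompact F, ∃ a b : ℤ, b ≤ a ∧ k₁ * g * k₂ = torus ϖ a b ∧
      height g = valuation F (ϖ : F) ^ b ∧
      valuation F (g : Matrix (Fin 2) (Fin 2) F).det = valuation F (ϖ : F) ^ (a + b) := by
  obtain ⟨k₁, hk₁, k₂, hk₂, a, b, hab, e⟩ := exists_mul_eq_torus h g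
  refine ⟨k₁, hk₁, k₂, hk₂, a, b, hab, e, ?_, ?_⟩
  · rw [← height_torus h hab, ← e, height_mul_right hk₂, height_mul_left hk₁]
  · rw [← map_zpow₀, ← det_torus, ← e, valuation_det_mul_mul hk₁ hk₂]

/-- The double coset `K diag(ϖ^a, ϖ^b) K` with `a ≥ b` is cut out by the height and the valuation of
the determinant. -/
theorem mem_doubleCoset_torus_iff {ϖ : Fˣ} (h : IsUniformizer ϖ) {a b : ℤ} (hab : b ≤ a)
    (g : GL (Fin 2) F) :
    g ∈ DoubleCoset.doubleCoset (torus ϖ a b) (maxCompact F : Set (GL (Fin 2) F)) (maxCompact F) ↔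
      height g = valuation F (ϖ : F) ^ b ∧
        valuation F (g : Matrix (Fin 2) (Fin 2) F).det = valuation F (ϖ : F) ^ (a + b) := by
  rw [DoubleCoset.mem_doubleCoset]
  constructor
  · rintro ⟨k₁, hk₁, k₂, hk₂, rfl⟩
    rw [height_mul_right hk₂, height_mul_left hk₁, height_torus h hab,
      valuation_det_mul_mul hk₁ hk₂, det_torus, map_zpow₀]
    exact ⟨rfl, rfl⟩
  · rintro ⟨h1, h2⟩
    obtain ⟨k₁, hk₁, k₂, hk₂, a', b', hab', e, e1, e2⟩ := cartan_decomposition h g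
    rw [h1, h.zpow_inj] at e1
    rw [h2, h.zpow_inj] at e2
    obtain rfl : a = a' := by omega
    subst e1
    exact ⟨k₁⁻¹, inv_mem hk₁, k₂⁻¹, inv_mem hk₂, by rw [← e]; group⟩

end Cartan

/-! ### Hecke operators as explicit functions -/

section Hecke

variable {F : Type*} [Field F] [ValuativeRel F] [TopologicalSpace F] [IsNonarchimedeanLocalField F]

open ValuativeRel (valuation)

theorem isLocallyConstant_of_right_invariant {f : GL (Fin 2) F → ℂ}
    (hf : ∀ k ∈ maxCompact F, ∀ g, f (g * k) = f g) : IsLocallyConstant f := by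
  rw [IsLocallyConstant.iff_exists_open]
  intro g
  refine ⟨(fun x => g⁻¹ * x) ⁻¹' (maxCompact F : Set (GL (Fin 2) F)),
    (isOpen_maxCompact F).preimage (continuous_const_mul g⁻¹), by simp, fun x hx => ?_⟩
  simpa using hf _ hx g

theorem charDoubleCoset_mem (g : GL (Fin 2) F) : charDoubleCoset g ∈ heckeAlgebra F := by
  have := t2Space F
  have hinv : ∀ k ∈ maxCompact F, ∀ x, charDoubleCoset g (k * x) = charDoubleCoset g x ∧
      charDoubleCoset g (x * k) = charDoubleCoset g x := by
    intro k hk x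
    have key : ∀ y z : GL (Fin 2) F, (y ∈ DoubleCoset.doubleCoset g
        (maxCompact F : Set (GL (Fin 2) F)) (maxCompact F) ↔ z ∈ DoubleCoset.doubleCoset g
        (maxCompact F : Set (GL (Fin 2) F)) (maxCompact F)) →
        charDoubleCoset g y = charDoubleCoset g z := by
      intro y z hyz
      classical
      simp only [charDoubleCoset, Set.indicator_apply, hyz, Pi.one_apply]
    refine ⟨key _ _ ?_, key _ _ ?_⟩
    · simp only [DoubleCoset.mem_doubleCoset]
      constructor
      · rintro ⟨k₁, hk₁, k₂, hk₂, e⟩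
        exact ⟨k⁻¹ * k₁, mul_mem (inv_mem hk) hk₁, k₂, hk₂, by
          rw [mul_assoc, mul_assoc, ← mul_assoc k₁, ← e, inv_mul_cancel_left]⟩
      · rintro ⟨k₁, hk₁, k₂, hk₂, rfl⟩
        exact ⟨k * k₁, mul_mem hk hk₁, k₂, hk₂, by simp only [mul_assoc]⟩
    · simp only [DoubleCoset.mem_doubleCoset]
      constructor
      · rintro ⟨k₁, hk₁, k₂, hk₂, e⟩
        exact ⟨k₁, hk₁, k₂ * k⁻¹, mul_mem hk₂ (inv_mem hk), by
          rw [← mul_assoc, ← e, mul_inv_cancel_right]⟩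
      · rintro ⟨k₁, hk₁, k₂, hk₂, rfl⟩
        exact ⟨k₁, hk₁, k₂ * k, mul_mem hk₂ hk, by simp only [mul_assoc]⟩
  refine ⟨isLocallyConstant_of_right_invariant fun k hk x => (hinv k hk x).2, ?_, hinv⟩
  have hc : IsCompact ((fun p : GL (Fin 2) F × GL (Fin 2) F => p.1 * g * p.2) ''
      ((maxCompact F : Set (GL (Fin 2) F)) ×ˢ (maxCompact F : Set (GL (Fin 2) F)))) :=
    ((isCompact_maxCompact F).prod (isCompact_maxCompact F)).image (by fun_prop)
  refine HasCompactSupport.intro hc fun x hx => Set.indicator_of_notMem (fun hx' => hx ?_) _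
  obtain ⟨k₁, hk₁, k₂, hk₂, rfl⟩ := DoubleCoset.mem_doubleCoset.mp hx'
  exact ⟨(k₁, k₂), ⟨hk₁, hk₂⟩, rfl⟩

theorem heckeOne_mem (ϖ : Fˣ) (m : ℕ) : heckeOne ϖ m ∈ heckeAlgebra F :=
  Submodule.sum_mem _ fun _ _ => charDoubleCoset_mem _

open Classical in
/-- `𝟙_m` is the characteristic function of the integral matrices whose determinant generates
`𝔭^m`. -/
theorem heckeOne_apply {ϖ : Fˣ} (h : IsUniformizer ϖ) (m : ℕ) (g : GL (Fin 2) F) :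
    heckeOne ϖ m g = if height g ≤ 1 ∧
      valuation F (g : Matrix (Fin 2) (Fin 2) F).det = valuation F (ϖ : F) ^ (m : ℤ)
      then 1 else 0 := by
  have happ : heckeOne ϖ m g = ∑ p ∈ Finset.HasAntidiagonal.antidiagonal m with p.2 ≤ p.1,
      if height g = valuation F (ϖ : F) ^ (p.2 : ℤ) ∧
        valuation F (g : Matrix (Fin 2) (Fin 2) F).det = valuation F (ϖ : F) ^ (m : ℤ)
      then (1 : ℂ) else 0 := by
    rw [heckeOne, Finset.sum_apply]
    refine Finset.sum_congr rfl fun p hp => ?_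
    rw [Finset.mem_filter, Finset.HasAntidiagonal.mem_antidiagonal] at hp
    rw [charDoubleCoset, Set.indicator_apply, mem_doubleCoset_torus_iff h (by exact_mod_cast hp.2)]
    have : ((p.1 : ℤ) + p.2) = m := by exact_mod_cast hp.1
    rw [this]
    split_ifs <;> rfl
  rw [happ]
  split_ifs with hg
  · obtain ⟨-, -, -, -, a, b, hab, -, e1, e2⟩ := cartan_decomposition h g
    rw [hg.2, h.zpow_inj] at e2
    have hb : 0 ≤ b := by
      have := hg.1
      rwa [e1, ← zpow_zero (valuation F (ϖ : F)), h.zpow_le_zpow_iff] at this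
    rw [Finset.sum_eq_single (a.toNat, b.toNat)]
    · refine if_pos ⟨?_, hg.2⟩
      rw [e1, h.zpow_inj]
      simp [hb]
    · intro p hp hne
      rw [Finset.mem_filter, Finset.HasAntidiagonal.mem_antidiagonal] at hp
      refine if_neg fun hh => hne ?_
      have h1 := hh.1
      rw [e1, h.zpow_inj] at h1
      ext <;> simp only <;> omega
    · intro hn
      refine absurd ?_ hn
      rw [Finset.mem_filter, Finset.HasAntidiagonal.mem_antidiagonal]
      simp only
      omega
  · refine Finset.sum_eq_zero fun p _ => if_neg fun hh => hg ⟨?_, hh.2⟩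
    rw [hh.1, ← zpow_zero (valuation F (ϖ : F)), h.zpow_le_zpow_iff]
    omega

theorem torus_mul_comm (ϖ : Fˣ) (i : ℤ) (g : GL (Fin 2) F) :
    torus ϖ i i * g = g * torus ϖ i i := by
  apply Units.ext
  rw [Units.val_mul, Units.val_mul]
  ext r s
  fin_cases r <;> fin_cases s <;> simp [torus, Matrix.mul_apply, mul_comm]

/-- The double coset of the central element `z = diag(ϖ^i, ϖ^i)` is `zK`, so
`x⁻¹ g` lies in it exactly when `x ∈ g z⁻¹ K`. -/
theorem heckeScalar_inv_mul (ϖ : Fˣ) (i : ℤ) (g x : GL (Fin 2) F) :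
    heckeScalar ϖ i (x⁻¹ * g) =
      ((fun x => (g * (torus ϖ i i)⁻¹)⁻¹ * x) ⁻¹' (maxCompact F : Set (GL (Fin 2) F))).indicator
        1 x := by
  rw [heckeScalar, charDoubleCoset]
  have : (x⁻¹ * g) ∈ DoubleCoset.doubleCoset (torus ϖ i i)
      (maxCompact F : Set (GL (Fin 2) F)) (maxCompact F) ↔ x ∈
      ((fun x => (g * (torus ϖ i i)⁻¹)⁻¹ * x) ⁻¹' (maxCompact F : Set (GL (Fin 2) F))) := by
    rw [DoubleCoset.mem_doubleCoset, Set.mem_preimage, mul_inv_rev, inv_inv]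
    constructor
    · rintro ⟨k₁, hk₁, k₂, hk₂, e⟩
      have : torus ϖ i i * g⁻¹ * x = (k₁ * k₂)⁻¹ := by
        have e' : g⁻¹ * x = (k₁ * torus ϖ i i * k₂)⁻¹ := by rw [← e, mul_inv_rev, inv_inv]
        rw [mul_assoc, e', ← torus_mul_comm ϖ i k₁, torus_mul_comm]
        group
      rw [this]
      exact inv_mem (mul_mem hk₁ hk₂)
    · intro hk
      refine ⟨_, inv_mem hk, 1, one_mem _, ?_⟩
      group
  by_cases hx : x ∈
      ((fun x => (g * (torus ϖ i i)⁻¹)⁻¹ * x) ⁻¹' (maxCompact F : Set (GL (Fin 2) F)))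
  · rw [Set.indicator_of_mem hx, Set.indicator_of_mem (this.mpr hx)]
    rfl
  · rw [Set.indicator_of_notMem hx, Set.indicator_of_notMem (mt this.mp hx)]

/-- Convolution with the characteristic function of a central double coset is a translation. -/
theorem conv_heckeScalar (ϖ : Fˣ) (i : ℤ) {f : GL (Fin 2) F → ℂ}
    (hf : ∀ k ∈ maxCompact F, ∀ g, f (g * k) = f g) (g : GL (Fin 2) F) :
    conv f (heckeScalar ϖ i) g = f (g * (torus ϖ i i)⁻¹) := by
  let _ : MeasurableSpace (GL (Fin 2) F) := borel (GL (Fin 2) F)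
  have : BorelSpace (GL (Fin 2) F) := ⟨rfl⟩
  let 𝒦 : TopologicalSpace.PositiveCompacts (GL (Fin 2) F) :=
    ⟨⟨(maxCompact F : Set (GL (Fin 2) F)), isCompact_maxCompact F⟩,
      ⟨1, by rw [(isOpen_maxCompact F).interior_eq]; exact one_mem (maxCompact F)⟩⟩
  have hself : haarGL2 F (maxCompact F : Set (GL (Fin 2) F)) = 1 :=
    MeasureTheory.Measure.haarMeasure_self (K₀ := 𝒦)
  have : (haarGL2 F).IsHaarMeasure := MeasureTheory.Measure.isHaarMeasure_haarMeasure 𝒦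
  set w := g * (torus ϖ i i)⁻¹ with hw
  have hint : ∀ x, f x * heckeScalar ϖ i (x⁻¹ * g) =
      ((fun x => w⁻¹ * x) ⁻¹' (maxCompact F : Set (GL (Fin 2) F))).indicator
        (fun _ => f w) x := by
    intro x
    rw [heckeScalar_inv_mul, ← hw]
    by_cases hx : x ∈ (fun x => w⁻¹ * x) ⁻¹' (maxCompact F : Set (GL (Fin 2) F))
    · rw [Set.indicator_of_mem hx, Set.indicator_of_mem hx, Pi.one_apply, mul_one, ← hf _ hx w,
        mul_inv_cancel_left]
    · rw [Set.indicator_of_notMem hx, Set.indicator_of_notMem hx, mul_zero]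
  rw [conv, MeasureTheory.integral_congr_ae (Filter.Eventually.of_forall hint),
    MeasureTheory.integral_indicator_const _
      ((isOpen_maxCompact F).preimage (continuous_const_mul w⁻¹)).measurableSet,
    MeasureTheory.measureReal_def, MeasureTheory.measure_preimage_mul, hself]
  simp

theorem conv_heckeScalar_mem (ϖ : Fˣ) (i : ℤ) {f : GL (Fin 2) F → ℂ} (hf : f ∈ heckeAlgebra F) :
    conv f (heckeScalar ϖ i) ∈ heckeAlgebra F := by
  have e : conv f (heckeScalar ϖ i) = f ∘ Homeomorph.mulRight (torus ϖ i i)⁻¹ :=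
    funext fun g => conv_heckeScalar ϖ i (fun k hk g => (hf.2.2 k hk g).2) g
  rw [e]
  refine ⟨hf.1.comp_continuous (Homeomorph.continuous _), hf.2.1.comp_homeomorph _,
    fun k hk g => ⟨?_, ?_⟩⟩
  · simpa [mul_assoc] using (hf.2.2 k hk (g * (torus ϖ i i)⁻¹)).1
  · have hcomm : k * (torus ϖ i i)⁻¹ = (torus ϖ i i)⁻¹ * k := by
      rw [mul_inv_eq_iff_eq_mul, mul_assoc, ← torus_mul_comm, inv_mul_cancel_left]
    simpa [mul_assoc, hcomm] using (hf.2.2 k hk (g * (torus ϖ i i)⁻¹)).2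

theorem height_mul_torus_inv {ϖ : Fˣ} (i : ℤ) (g : GL (Fin 2) F) :
    height (g * (torus ϖ i i)⁻¹) ≤ 1 ↔ height g ≤ valuation F (ϖ : F) ^ i := by
  have hpos : 0 < valuation F (ϖ : F) ^ i := zero_lt_iff.mpr (by simp [zpow_ne_zero])
  have key : ∀ r s, valuation F (((g * (torus ϖ i i)⁻¹ : GL (Fin 2) F) :
      Matrix (Fin 2) (Fin 2) F) r s) = valuation F ((g : Matrix (Fin 2) (Fin 2) F) r s) *
        (valuation F (ϖ : F) ^ i)⁻¹ := by
    intro r s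
    rw [Units.val_mul]
    simp only [torus, Units.inv_mk]
    fin_cases s <;> simp [Matrix.mul_apply]
  simp only [height_le_iff, key, mul_inv_le_iff₀ hpos, one_mul]

open Classical in
/-- `𝟙_m * 𝟙_{i,i}` is the characteristic function of the matrices with entries in `𝔭^i` and with
determinant generating `𝔭^{m+2i}`. -/
theorem conv_heckeOne_heckeScalar_apply {ϖ : Fˣ} (h : IsUniformizer ϖ) (m : ℕ) (i : ℤ)
    (g : GL (Fin 2) F) :
    conv (heckeOne ϖ m) (heckeScalar ϖ i) g = if height g ≤ valuation F (ϖ : F) ^ i ∧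
      valuation F (g : Matrix (Fin 2) (Fin 2) F).det = valuation F (ϖ : F) ^ (m + 2 * i : ℤ)
      then 1 else 0 := by
  rw [conv_heckeScalar ϖ i (fun k hk g => ((heckeOne_mem ϖ m).2.2 k hk g).2), heckeOne_apply h]
  have hne : valuation F (ϖ : F) ≠ 0 := by simp
  have hdet : ((torus ϖ i i)⁻¹ : GL (Fin 2) F).det = ϖ ^ (-(2 * i)) := by
    rw [map_inv, zpow_neg]
    congr 1
    apply Units.ext
    rw [Matrix.GeneralLinearGroup.val_det_apply, det_torus, Units.val_zpow_eq_zpow_val, two_mul]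
  have hdet' := congrArg Units.val hdet
  rw [Matrix.GeneralLinearGroup.val_det_apply, Units.val_zpow_eq_zpow_val] at hdet'
  refine if_congr (and_congr (height_mul_torus_inv i g) ?_) rfl rfl
  rw [Units.val_mul, Matrix.det_mul, hdet', map_mul, map_zpow₀, zpow_neg,
    mul_inv_eq_iff_eq_mul₀ (zpow_ne_zero _ hne), ← zpow_add₀ hne]

end Hecke

/-! ### Injectivity of the Satake transform -/

section Satake

variable {F : Type*} [Field F] [ValuativeRel F] [TopologicalSpace F] [IsNonarchimedeanLocalField F]

open ValuativeRel (valuation)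

theorem satake_coeff {ϖ : Fˣ} (h : IsUniformizer ϖ) (f : heckeAlgebra F) (a b : ℤ) :
    (satake h f).coeff (a, b) = satakeCoeff ϖ f a b := rfl

theorem torus_mul_unip_val (ϖ : Fˣ) (a b : ℤ) (x : F) :
    ((torus ϖ a b * unip x : GL (Fin 2) F) : Matrix (Fin 2) (Fin 2) F) =
      !![(ϖ : F) ^ a, (ϖ : F) ^ a * x; 0, (ϖ : F) ^ b] := by
  rw [Units.val_mul]
  ext i j
  fin_cases i <;> fin_cases j <;> simp [torus, unip, Matrix.mul_apply]

theorem height_torus_mul_unip_le_iff {ϖ : Fˣ} (h : IsUniformizer ϖ) (a b i : ℤ) (x : F) :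
    height (torus ϖ a b * unip x) ≤ valuation F (ϖ : F) ^ i ↔
      (i ≤ a ∧ i ≤ b) ∧ valuation F x ≤ valuation F (ϖ : F) ^ (i - a) := by
  have hne : valuation F (ϖ : F) ≠ 0 := by simp
  have hpos : 0 < valuation F (ϖ : F) ^ a := zero_lt_iff.mpr (by simp [zpow_ne_zero])
  have hx : valuation F (ϖ : F) ^ a * valuation F x ≤ valuation F (ϖ : F) ^ i ↔
      valuation F x ≤ valuation F (ϖ : F) ^ (i - a) := by
    rw [zpow_sub₀ hne, le_div_iff₀ hpos, mul_comm]
  rw [height_le_iff, torus_mul_unip_val, ← hx]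
  constructor
  · intro H
    have h1 := H 0 0
    have h2 := H 0 1
    have h3 := H 1 1
    simp only [Matrix.of_apply, Matrix.cons_val', Matrix.cons_val_zero, Matrix.cons_val_one,
      Matrix.cons_val_fin_one, map_mul, map_zpow₀, h.zpow_le_zpow_iff] at h1 h2 h3
    exact ⟨⟨h1, h3⟩, h2⟩
  · rintro ⟨⟨h1, h3⟩, h2⟩ r s
    fin_cases r <;> fin_cases s <;> simp [h.zpow_le_zpow_iff, h1, h2, h3]

theorem det_torus_mul_unip (ϖ : Fˣ) (a b : ℤ) (x : F) :
    ((torus ϖ a b * unip x : GL (Fin 2) F) : Matrix (Fin 2) (Fin 2) F).det = (ϖ : F) ^ (a + b) := by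
  rw [torus_mul_unip_val]
  simp [Matrix.det_fin_two, zpow_add₀]

theorem continuous_torus_mul_unip (ϖ : Fˣ) (a b : ℤ) :
    Continuous fun x : F => torus ϖ a b * unip x := by
  refine continuous_const.mul (Units.continuous_iff.mpr ⟨?_, ?_⟩)
  · refine continuous_matrix fun i j => ?_
    fin_cases i <;> fin_cases j <;> simp [unip] <;> fun_prop
  · refine continuous_matrix fun i j => ?_
    have : ∀ x : F, (unip x)⁻¹ = unip (-x) := fun x =>
      (AddChar.map_neg_eq_inv Matrix.GeneralLinearGroup.upperRightHom x).symm
    simp only [this]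
    fin_cases i <;> fin_cases j <;> simp [unip] <;> fun_prop

theorem integrable_torus_mul_unip (ϖ : Fˣ) (a b : ℤ) (f : heckeAlgebra F) :
    MeasureTheory.Integrable
      (fun x : F => (f : GL (Fin 2) F → ℂ) (torus ϖ a b * unip x)) (haarF F) := by
  let _ : MeasurableSpace F := borel F
  have : BorelSpace F := ⟨rfl⟩
  have := t2Space F
  have : (haarF F).IsAddHaarMeasure :=
    MeasureTheory.Measure.isAddHaarMeasure_addHaarMeasure _
  refine Continuous.integrable_of_hasCompactSupport
    (f.2.1.continuous.comp (continuous_torus_mul_unip ϖ a b)) ?_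
  have hc : IsCompact ((fun g : GL (Fin 2) F => ((ϖ : F) ^ a)⁻¹ *
      (g : Matrix (Fin 2) (Fin 2) F) 0 1) '' tsupport (f : GL (Fin 2) F → ℂ)) :=
    f.2.2.1.isCompact.image (continuous_const.mul (Units.continuous_val.matrix_elem 0 1))
  refine HasCompactSupport.intro hc fun x hx => ?_
  by_contra hne
  refine hx ⟨_, subset_tsupport _ hne, ?_⟩
  simp only [torus_mul_unip_val]
  simp [zpow_ne_zero]

theorem eq_of_torus_eq {ϖ : Fˣ} (h : IsUniformizer ϖ) {f f' : heckeAlgebra F}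
    (H : ∀ a b : ℤ, b ≤ a → (f : GL (Fin 2) F → ℂ) (torus ϖ a b) =
      (f' : GL (Fin 2) F → ℂ) (torus ϖ a b)) : f = f' := by
  ext g
  obtain ⟨k₁, hk₁, k₂, hk₂, a, b, hab, e⟩ := exists_mul_eq_torus h g
  have := H a b hab
  rwa [← e, (f.2.2.2 k₂ hk₂ _).2, (f.2.2.2 k₁ hk₁ _).1, (f'.2.2.2 k₂ hk₂ _).2,
    (f'.2.2.2 k₁ hk₁ _).1] at this

/-- On the double cosets of a fixed determinant, ordered by height, the Satake transform is
triangular with nonzero diagonal entries: `diag(ϖ^a, ϖ^b) n(x)` has height at least `|ϖ^b|`, and it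
lies in `K diag(ϖ^a, ϖ^b) K` for `x` in a ball. -/
theorem satake_injective {ϖ : Fˣ} (h : IsUniformizer ϖ) :
    Function.Injective (satake h : heckeAlgebra F → ℂ[ℤ × ℤ]) := by
  intro f₁ f₂ h12
  set d : heckeAlgebra F := f₁ - f₂ with hd
  have hint : ∀ a b : ℤ, ∫ x, (d : GL (Fin 2) F → ℂ) (torus ϖ a b * unip x) ∂(haarF F) = 0 := by
    intro a b
    have h1 : satakeCoeff ϖ f₁ a b = satakeCoeff ϖ f₂ a b := by
      rw [← satake_coeff h, ← satake_coeff h, h12]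
    have hq : (((q F : ℝ) ^ (((b : ℝ) - a) / 2) : ℝ) : ℂ) ≠ 0 := by
      rw [Complex.ofReal_ne_zero]
      exact (Real.rpow_pos_of_pos (by exact_mod_cast one_lt_q.le) _).ne'
    have h2 := mul_left_cancel₀ hq h1
    have h3 : ∀ x, (d : GL (Fin 2) F → ℂ) (torus ϖ a b * unip x) =
      (f₁ : GL (Fin 2) F → ℂ) (torus ϖ a b * unip x) -
        (f₂ : GL (Fin 2) F → ℂ) (torus ϖ a b * unip x) := fun x => rfl
    simp only [h3]
    rw [MeasureTheory.integral_sub (integrable_torus_mul_unip ϖ a b f₁)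
      (integrable_torus_mul_unip ϖ a b f₂), h2, sub_self]
  rw [← sub_eq_zero, ← hd]
  -- Compact support bounds the heights from above, which starts the induction.
  obtain ⟨N, hN⟩ := h.exists_bound
    (d.2.2.1.isCompact.image (Units.continuous_val.matrix_elem (1 : Fin 2) (1 : Fin 2)))
  have hbase : ∀ a b : ℤ, b < -N → (d : GL (Fin 2) F → ℂ) (torus ϖ a b) = 0 := by
    intro a b hb
    by_contra hne
    have := hN b ⟨_, subset_tsupport _ hne, by simp [torus]⟩
    omega
  have key : ∀ n : ℕ, ∀ a b : ℤ, b ≤ a → b < -N + n →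
      (d : GL (Fin 2) F → ℂ) (torus ϖ a b) = 0 := by
    intro n
    induction n with
    | zero => exact fun a b _ hb => hbase a b (by simpa using hb)
    | succ n ih =>
      intro a b hab hb
      have hval : ∀ x, (d : GL (Fin 2) F → ℂ) (torus ϖ a b * unip x) =
          {x : F | valuation F x ≤ valuation F (ϖ : F) ^ (b - a)}.indicator
            (fun _ => (d : GL (Fin 2) F → ℂ) (torus ϖ a b)) x := by
        intro x
        obtain ⟨k₁, hk₁, k₂, hk₂, a', b', hab', e, e1, e2⟩ :=
          cartan_decomposition h (torus ϖ a b * unip x)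
        have e0 : (d : GL (Fin 2) F → ℂ) (torus ϖ a b * unip x) =
            (d : GL (Fin 2) F → ℂ) (torus ϖ a' b') := by
          rw [← e, (d.2.2.2 k₂ hk₂ _).2, (d.2.2.2 k₁ hk₁ _).1]
        rw [det_torus_mul_unip, map_zpow₀, h.zpow_inj] at e2
        have e3 := fun i => height_torus_mul_unip_le_iff h a b i x
        simp only [e1, h.zpow_le_zpow_iff] at e3
        rw [e0]
        by_cases hx : x ∈ {x : F | valuation F x ≤ valuation F (ϖ : F) ^ (b - a)}
        · rw [Set.indicator_of_mem hx]
          have hb' : b = b' := by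
            have h1 := (e3 b).mpr ⟨⟨hab, le_rfl⟩, hx⟩
            have h2 := ((e3 b').mp le_rfl).1.2
            omega
          rw [← hb', show a' = a by omega]
        · rw [Set.indicator_of_notMem hx]
          have h2 := ((e3 b').mp le_rfl).1.2
          have h3 : ¬ b ≤ b' := fun hle => hx ((e3 b).mp hle).2
          exact ih a' b' hab' (by push_cast at hb; omega)
      have h0 := hint a b
      simp only [hval] at h0
      rw [integral_indicator_ball h] at h0
      refine (mul_eq_zero.mp h0).resolve_left (zpow_ne_zero _ ?_)
      exact_mod_cast (one_lt_q (F := F)).ne_bot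
  refine eq_of_torus_eq h fun a b hab => ?_
  exact key (b + N + 1).toNat a b hab (by omega)

/-- `𝒮(𝟙_{2m} * 𝟙_{i,i}) = q^m h_{2m}(t₁, t₂) (t₁t₂)^i`. For an even index the powers of `q` are
integral. -/
theorem satakeCoeff_conv {ϖ : Fˣ} (h : IsUniformizer ϖ) (m : ℕ) (i a b : ℤ) :
    satakeCoeff ϖ (conv (heckeOne ϖ (2 * m)) (heckeScalar ϖ i)) a b =
      if a + b = 2 * m + 2 * i ∧ i ≤ a ∧ i ≤ b then (q F : ℂ) ^ m else 0 := by
  classical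
  have hval : ∀ x, conv (heckeOne ϖ (2 * m)) (heckeScalar ϖ i) (torus ϖ a b * unip x) =
      {x : F | valuation F x ≤ valuation F (ϖ : F) ^ (i - a)}.indicator
        (fun _ => if a + b = 2 * m + 2 * i ∧ i ≤ a ∧ i ≤ b then (1 : ℂ) else 0) x := by
    intro x
    rw [conv_heckeOne_heckeScalar_apply h, Set.indicator_apply, ← ite_and]
    refine if_congr ?_ rfl rfl
    rw [height_torus_mul_unip_le_iff h, det_torus_mul_unip, map_zpow₀, h.zpow_inj,
      Set.mem_ofPred_eq]
    push_cast
    tauto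
  rw [satakeCoeff]
  simp only [hval]
  rw [integral_indicator_ball h]
  split_ifs with hab
  · have hq : (0 : ℝ) < q F := by exact_mod_cast one_lt_q.le
    rw [mul_one]
    have : ((q F : ℂ) ^ (-(i - a)) : ℂ) = (((q F : ℝ) ^ (-((i : ℝ) - a)) : ℝ) : ℂ) := by
      rw [show -((i : ℝ) - a) = ((-(i - a) : ℤ) : ℝ) by push_cast; ring, Real.rpow_intCast]
      push_cast
      rfl
    rw [this, ← Complex.ofReal_mul, ← Real.rpow_add hq]
    have e : ((b : ℝ) - a) / 2 + -((i : ℝ) - a) = m := by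
      have : (a : ℝ) + b = 2 * m + 2 * i := by exact_mod_cast hab.1
      linarith
    rw [e, Real.rpow_natCast]
    push_cast
    rfl
  · simp

end Satake

/-! ### The basic function of `Sym⁴` -/

section BasicFunction

variable {F : Type*} [Field F] [ValuativeRel F] [TopologicalSpace F] [IsNonarchimedeanLocalField F]

open ValuativeRel (valuation)

/-- The bracket multiplying `q^n` in `S_j` is `plethysmMult j n`. -/
theorem heckeS_eq_sum (ϖ : Fˣ) (j : ℕ) :
    heckeS ϖ j = ∑ n ∈ Finset.Icc 0 (2 * j), ((q F : ℂ) ^ n * (plethysmMult j n : ℂ)) •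
      conv (heckeOne ϖ (2 * (2 * j - n))) (heckeScalar ϖ n) := by
  have hfilter : Finset.Icc (j + 1) (2 * j) =
      (Finset.Icc 0 (2 * j)).filter fun n => j + 1 ≤ n := by
    ext n
    simp only [Finset.mem_Icc, Finset.mem_filter]
    omega
  rw [heckeS, hfilter, Finset.sum_filter, ← Finset.sum_sub_distrib]
  refine Finset.sum_congr rfl fun n _ => ?_
  rw [show 4 * j - 2 * n = 2 * (2 * j - n) by omega]
  simp only [plethysmMult, quarterSum, partialSum]
  split_ifs
  · push_cast
    rw [← sub_smul, mul_sub]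
  · push_cast
    rw [sub_zero, sub_zero]

theorem conv_heckeOne_heckeScalar_mem (ϖ : Fˣ) (m : ℕ) (i : ℤ) :
    conv (heckeOne ϖ m) (heckeScalar ϖ i) ∈ heckeAlgebra F :=
  conv_heckeScalar_mem ϖ i (heckeOne_mem ϖ m)

theorem heckeS_mem (ϖ : Fˣ) (j : ℕ) : heckeS ϖ j ∈ heckeAlgebra F := by
  rw [heckeS_eq_sum]
  exact Submodule.sum_mem _ fun n _ =>
    Submodule.smul_mem _ _ (conv_heckeOne_heckeScalar_mem ϖ _ _)

theorem satakeCoeff_sum_smul {ι : Type*} (ϖ : Fˣ) (s : Finset ι) (c : ι → ℂ)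
    (f : ι → heckeAlgebra F) (a b : ℤ) :
    satakeCoeff ϖ (∑ n ∈ s, c n • (f n : GL (Fin 2) F → ℂ)) a b =
      ∑ n ∈ s, c n * satakeCoeff ϖ (f n) a b := by
  simp only [satakeCoeff, Finset.sum_apply, Pi.smul_apply, smul_eq_mul]
  rw [MeasureTheory.integral_finsetSum _ fun n _ =>
    (integrable_torus_mul_unip ϖ a b (f n)).const_mul (c n), Finset.mul_sum]
  refine Finset.sum_congr rfl fun n _ => ?_
  rw [MeasureTheory.integral_const_mul]
  ring

/-- `q^{-2j} S_j` as an element of the Hecke algebra. -/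
noncomputable def normalizedHeckeS (ϖ : Fˣ) (j : ℕ) : heckeAlgebra F :=
  (q F : ℂ) ^ (-2 * (j : ℤ)) • ⟨heckeS ϖ j, heckeS_mem ϖ j⟩

theorem normalizedHeckeS_apply (ϖ : Fˣ) (j : ℕ) (g : GL (Fin 2) F) :
    (normalizedHeckeS ϖ j : GL (Fin 2) F → ℂ) g = heckeS ϖ j g * (q F : ℂ) ^ (-2 * (j : ℤ)) :=
  mul_comm _ _

theorem satake_normalizedHeckeS {ϖ : Fˣ} (h : IsUniformizer ϖ) (j : ℕ) :
    satake h (normalizedHeckeS ϖ j) = symSym 4 j := by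
  have hq : (q F : ℂ) ≠ 0 := by exact_mod_cast (one_lt_q (F := F)).ne_bot
  have hsum : (normalizedHeckeS ϖ j : GL (Fin 2) F → ℂ) = ∑ n ∈ Finset.Icc 0 (2 * j),
      ((q F : ℂ) ^ (-2 * (j : ℤ)) * ((q F : ℂ) ^ n * (plethysmMult j n : ℂ))) •
        ((⟨_, conv_heckeOne_heckeScalar_mem ϖ (2 * (2 * j - n)) n⟩ : heckeAlgebra F) :
          GL (Fin 2) F → ℂ) := by
    change (q F : ℂ) ^ (-2 * (j : ℤ)) • heckeS ϖ j = _
    rw [heckeS_eq_sum, Finset.smul_sum]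
    simp only [smul_smul]
  refine AddMonoidAlgebra.coeff_injective (Finsupp.ext fun p => ?_)
  obtain ⟨a, b⟩ := p
  rw [satake_coeff, hsum, satakeCoeff_sum_smul, symSym_four_coeff]
  have hterm : ∀ n ∈ Finset.Icc 0 (2 * j),
      ((q F : ℂ) ^ (-2 * (j : ℤ)) * ((q F : ℂ) ^ n * (plethysmMult j n : ℂ))) *
        satakeCoeff ϖ (conv (heckeOne ϖ (2 * (2 * j - n))) (heckeScalar ϖ n)) a b =
      if a + b = 4 * j then (if (n : ℤ) ≤ a ∧ (n : ℤ) ≤ b then (plethysmMult j n : ℂ) else 0)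
        else 0 := by
    intro n hn
    have hn' : n ≤ 2 * j := (Finset.mem_Icc.mp hn).2
    rw [satakeCoeff_conv h, ← ite_and]
    have hcond : (a + b = 2 * ((2 * j - n : ℕ) : ℤ) + 2 * n ∧ (n : ℤ) ≤ a ∧ (n : ℤ) ≤ b) ↔
        (a + b = 4 * j ∧ (n : ℤ) ≤ a ∧ (n : ℤ) ≤ b) := by omega
    simp only [hcond]
    split_ifs
    · have hpow : (q F : ℂ) ^ (-2 * (j : ℤ)) * ((q F : ℂ) ^ n * (q F : ℂ) ^ (2 * j - n)) = 1 := by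
        rw [← pow_add, ← zpow_natCast, ← zpow_add₀ hq,
          show -2 * (j : ℤ) + ((n + (2 * j - n) : ℕ) : ℤ) = 0 by omega, zpow_zero]
      linear_combination (plethysmMult j n : ℂ) * hpow
    · simp
  rw [Finset.sum_congr rfl hterm]
  split_ifs
  · rw [← Finset.sum_filter]
    push_cast
    rfl
  · exact Finset.sum_const_zero

theorem satakeInv_symSym_four {ϖ : Fˣ} (h : IsUniformizer ϖ) (j : ℕ) :
    satakeInv h (symSym 4 j) = normalizedHeckeS ϖ j :=
  satake_injective h ((Function.invFun_eq ⟨_, satake_normalizedHeckeS h j⟩).trans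
    (satake_normalizedHeckeS h j).symm)

/-- `S_j` is supported on the matrices whose determinant has valuation `4j`. -/
theorem finite_setOf_heckeS_ne_zero {ϖ : Fˣ} (h : IsUniformizer ϖ) (g : GL (Fin 2) F) :
    {j : ℕ | heckeS ϖ j g ≠ 0}.Finite := by
  have hdet : ∀ j : ℕ, heckeS ϖ j g ≠ 0 →
      valuation F (g : Matrix (Fin 2) (Fin 2) F).det = valuation F (ϖ : F) ^ (4 * j : ℤ) := by
    intro j hj
    rw [heckeS_eq_sum, Finset.sum_apply] at hj
    obtain ⟨n, hn, hne⟩ := Finset.exists_ne_zero_of_sum_ne_zero hj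
    have hn' := (Finset.mem_Icc.mp hn).2
    rw [Pi.smul_apply, conv_heckeOne_heckeScalar_apply h] at hne
    rw [((ite_ne_right_iff.mp (right_ne_zero_of_smul hne)).1).2]
    congr 1
    omega
  refine Set.Subsingleton.finite fun i hi j hj => ?_
  have := (hdet i hi).symm.trans (hdet j hj)
  rw [h.zpow_inj] at this
  omega

end BasicFunction
end SatakeGL2

theorem mainTheorem6 (F : Type*) [Field F] [ValuativeRel F] [TopologicalSpace F]
    [IsNonarchimedeanLocalField F] (ϖ : Fˣ) (hϖ : SatakeGL2.IsUniformizer ϖ) :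
    (∀ j : ℕ, ∃! f : SatakeGL2.heckeAlgebra F,
      SatakeGL2.satake hϖ f = SatakeGL2.symSym 4 j) ∧
    (∀ g : GL (Fin 2) F,
      {j : ℕ | (SatakeGL2.satakeInv hϖ (SatakeGL2.symSym 4 j) : GL (Fin 2) F → ℂ) g ≠ 0}.Finite ∧
      {j : ℕ | SatakeGL2.heckeS ϖ j g ≠ 0}.Finite) ∧
    SatakeGL2.basicFunction hϖ 4 =
      fun g => ∑' j : ℕ, SatakeGL2.heckeS ϖ j g * (SatakeGL2.q F : ℂ) ^ (-2 * (j : ℤ)) := by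
  refine ⟨fun j => ⟨_, SatakeGL2.satake_normalizedHeckeS hϖ j, fun f hf =>
    SatakeGL2.satake_injective hϖ (hf.trans (SatakeGL2.satake_normalizedHeckeS hϖ j).symm)⟩,
    fun g => ⟨?_, SatakeGL2.finite_setOf_heckeS_ne_zero hϖ g⟩, ?_⟩
  · refine (SatakeGL2.finite_setOf_heckeS_ne_zero hϖ g).subset fun j hj => ?_
    rw [Set.mem_ofPred_eq, SatakeGL2.satakeInv_symSym_four,
      SatakeGL2.normalizedHeckeS_apply] at hj
    exact left_ne_zero_of_mul hj
  · funext g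
    simp only [SatakeGL2.basicFunction, SatakeGL2.satakeInv_symSym_four,
      SatakeGL2.normalizedHeckeS_apply]
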